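/- Let $J\subseteq\mathbb R$ be an interval with $0\in J$ and let $J'\subseteq\mathbb R$ be a nonempty interval. A continuous function $f:J\to\mathbb R$ is operator convex if $f(\lambda A+(1-\lambda)B)\le\lambda f(A)+(1-\lambda)f(B)$ for all bounded self-adjoint operators $A,B$ on a complex Hilbert space with spectra in $J$ and all $\lambda\in[0,1]$; $f$ is operator concave if $-f$ is operator convex. For self-adjoint $L,R$ with $\mathrm{sp}(R)\subseteq J'$, a continuous $h:J'\to(0,\infty)$, and $\mathrm{sp}\big(h(R)^{-1/2}Lh(R)^{-1/2}\big)\subseteq J$, put $$(f\Delta h)(L,R)=h(R)^{1/2}\,f\big(h(R)^{-1/2}Lh(R)^{-1/2}\big)\,h(R)^{1/2}.$$ Let $T$ be a locally compact Hausdorff space with a nonzero bounded Radon measure $\mu$, and let $\mathfrak A$, $\mathfrak B$ be unital $C^*$-algebras of operators on nonzero complex Hilbert spaces (containing the identity operators). A unital field is a family $(\Phi_t)_{t\in T}$ of positive linear maps $\mathfrak A\to\mathfrak B$ such that $t\mapsto\Phi_t(X)$ is norm continuous for every $X\in\mathfrak A$ and $t\mapsto\Phi_t(I)$ is (Bochner)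 integrable with $\int_T\Phi_t(I)\,d\mu(t)=I$. A continuous field is a norm continuous map $t\mapsto A_t$ from $T$ to the self-adjoint elements of $\mathfrak A$. Let $f_1,f_2:J\to\mathbb R$ be operator convex with $f_1(0)\le0$ and $f_2(0)\le0$, and let $h:J'\to\mathbb R$ be operator concave with $h>0$. Then the following assertions are equivalent: (1) $f_1(x)\le f_2(x)$ for all $x\in J$; (2) $\displaystyle(f_1\Delta h)\Big(\int_T\Phi_t(A_t)\,d\mu(t),\int_T\Phi_t(B_t)\,d\mu(t)\Big)\le\int_T\Phi_t\big((f_2\Delta h)(A_t,B_t)\big)\,d\mu(t)$ for all unital fields $(\Phi_t)$ and all continuous fields $(A_t),(B_t)$ such that $\mathrm{sp}(B_t)\subseteq J'$ and $\mathrm{sp}\big(h(B_t)^{-1/2}A_th(B_t)^{-1/2}\big)\subseteq J$ for all $t$, and such that $\Phi_t(A_t)$, $\Phi_t(B_t)$ and $\Phi_t((f_2\Delta h)(A_t,B_t))$ are (Bochner) integrable in $t$; (3) $\displaystyle f_1\Big(\int_T\Phi_t(A_t)\,d\mu(t)\Big)\le\int_T\Phi_t(f_2(A_t))\,d\mu(t)$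 for all unital fields $(\Phi_t)$ and all continuous fields $(A_t)$ with $\mathrm{sp}(A_t)\subseteq J$ for all $t$ such that $\Phi_t(A_t)$ and $\Phi_t(f_2(A_t))$ are (Bochner) integrable in $t$. -/

import Mathlib

open MeasureTheory

universe u

/-- `f` is operator convex on the interval `J`: it is continuous there, and
`f(c A + (1 - c) B) ≤ c f(A) + (1 - c) f(B)` for all bounded self-adjoint operators `A`, `B` on a
complex Hilbert space with spectra in `J` and all `c ∈ [0, 1]`. -/
def OperatorConvexOn (J : Set ℝ) (f : ℝ → ℝ) : Prop :=
  J.OrdConnected ∧ ContinuousOn f J ∧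
    ∀ (H : Type u) [NormedAddCommGroup H] [InnerProductSpace ℂ H] [CompleteSpace H]
      (A B : H →L[ℂ] H), IsSelfAdjoint A → IsSelfAdjoint B →
      spectrum ℝ A ⊆ J → spectrum ℝ B ⊆ J → ∀ c : ℝ, 0 ≤ c → c ≤ 1 →
        cfc f (c • A + (1 - c) • B) ≤ c • cfc f A + (1 - c) • cfc f B

/-- `f` is operator concave on the interval `J` if `-f` is operator convex there. -/
def OperatorConcaveOn (J : Set ℝ) (f : ℝ → ℝ) : Prop :=
  OperatorConvexOn.{u} J (fun x => -f x)

section Perspective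

variable {𝔄 : Type*} [CStarAlgebra 𝔄]

/-- `h(R)^{1/2}`. -/
noncomputable def sqrtOf (h : ℝ → ℝ) (R : 𝔄) : 𝔄 :=
  cfc Real.sqrt (cfc h R)

/-- `h(R)^{-1/2}`. -/
noncomputable def invSqrtOf (h : ℝ → ℝ) (R : 𝔄) : 𝔄 :=
  cfc (fun x : ℝ => (Real.sqrt x)⁻¹) (cfc h R)

/-- `h(R)^{-1/2} L h(R)^{-1/2}`. -/
noncomputable def perspectiveArg (h : ℝ → ℝ) (L R : 𝔄) : 𝔄 :=
  invSqrtOf h R * L * invSqrtOf h R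

/-- The generalized operator perspective
`(f Δ h)(L, R) = h(R)^{1/2} f(h(R)^{-1/2} L h(R)^{-1/2}) h(R)^{1/2}`. -/
noncomputable def genPerspective (f h : ℝ → ℝ) (L R : 𝔄) : 𝔄 :=
  sqrtOf h R * cfc f (perspectiveArg h L R) * sqrtOf h R

/-- `(A t)` is a norm continuous field of self-adjoint elements with spectra in `J`. -/
def IsContinuousField {T : Type*} [TopologicalSpace T] (J : Set ℝ) (A : T → 𝔄) : Prop :=
  Continuous A ∧ ∀ t, IsSelfAdjoint (A t) ∧ spectrum ℝ (A t) ⊆ J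

/-- `(Φ t)` is a unital (continuous) field of positive linear maps: `t ↦ Φ t a` is continuous for
each `a`, and `t ↦ Φ t 1` is Bochner integrable with integral `1`. -/
def IsUnitalField {𝔅 : Type*} [CStarAlgebra 𝔅] [PartialOrder 𝔄] [PartialOrder 𝔅]
    {T : Type*} [TopologicalSpace T] [MeasurableSpace T] (μ : Measure T)
    (Φ : T → 𝔄 →ₚ[ℂ] 𝔅) : Prop :=
  (∀ a, Continuous fun t => Φ t a) ∧ Integrable (fun t => Φ t 1) μ ∧ ∫ t, Φ t 1 ∂μ = 1

end Perspective

/-! The core is a Jensen inequality for an operator convex `f` and positive maps: `f(∫ Ψ_t(X_t)) ≤ ∫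
Ψ_t(f(X_t))`. Complete positivity is not needed, since the maps only act on functions of `X_t`. For
compression by an isometry `V`, one averages `X` with its image under the reflection `2VV* - 1`
(`cfc_compression_le`). A column of square roots turns this into `f(∑ xᵢ Eᵢ) ≤ ∑ f(xᵢ) Eᵢ` for a
resolution of the identity (`cfc_sum_le`). If the spectra lie in `[a, b]`, then `g ↦ ∫ Ψ_t(g(X_t))`
is a positive map on continuous functions, and Bernstein operators, which fix affine functions,
reduce its Jensen inequality to finite sums (`cfc_map_le`).

For a general interval, `T` is exhausted by sets on which the spectra lie in a compact subinterval
(`IsSubunitalField.cfc_le`). Cutting `T` down destroys unitality, so the fields only satisfy `S = ∫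
Ψ_t(1) ≤ 1`, and the defect `1 - S` is treated as a mass at a point `x₀` of the interval.

For perspectives, Jensen for `-h` gives `∫ Ψ_t(h(B_t)) ≤ h(R)` with `R = ∫ Ψ_t(B_t)`. Hence `X ↦
h(R)^{-1/2} Ψ_t(h(B_t)^{1/2} X h(B_t)^{1/2}) h(R)^{-1/2}` is again subunital. Jensen for it, with
the defect at `0` where `f₂ ≤ 0`, gives the perspective inequality for `f₂`, and `f₁ ≤ f₂` then
gives (2). Constant scalar fields give the converses. -/

open Filter Topology ContinuousLinearMap

/-! ### Order bounds, spectra, and spectral permanence -/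

section SpectralOrder

variable {A : Type*} [CStarAlgebra A] [PartialOrder A] [StarOrderedRing A]

theorem spectrum_subset_Icc_of_le {X : A} {a b : ℝ} (hX : IsSelfAdjoint X)
    (ha : algebraMap ℝ A a ≤ X) (hb : X ≤ algebraMap ℝ A b) : spectrum ℝ X ⊆ Set.Icc a b :=
  fun x hx => ⟨(algebraMap_le_iff_le_spectrum hX).1 ha x hx,
    (le_algebraMap_iff_spectrum_le hX).1 hb x hx⟩

omit [PartialOrder A] [StarOrderedRing A] in
theorem IsSelfAdjoint.real_smul {X : A} (hX : IsSelfAdjoint X) (c : ℝ) : IsSelfAdjoint (c • X) := by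
  rw [IsSelfAdjoint, star_smul, hX.star_eq, star_trivial]

theorem exists_algebraMap_le_and_le {X : A} {J : Set ℝ} {x₀ : ℝ} (hx₀ : x₀ ∈ J)
    (hX : IsSelfAdjoint X) (hJ : spectrum ℝ X ⊆ J) :
    ∃ a ∈ J, ∃ b ∈ J, algebraMap ℝ A a ≤ X ∧ X ≤ algebraMap ℝ A b := by
  have hc : IsCompact (insert x₀ (spectrum ℝ X)) :=
    (ContinuousFunctionalCalculus.isCompact_spectrum X).insert x₀
  have hsub : insert x₀ (spectrum ℝ X) ⊆ J := Set.insert_subset hx₀ hJ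
  obtain ⟨a, ha, ha'⟩ := hc.exists_isLeast ⟨x₀, Set.mem_insert _ _⟩
  obtain ⟨b, hb, hb'⟩ := hc.exists_isGreatest ⟨x₀, Set.mem_insert _ _⟩
  exact ⟨a, hsub ha, b, hsub hb,
    (algebraMap_le_iff_le_spectrum hX).2 fun x hx => ha' (Set.mem_insert_of_mem _ hx),
    (le_algebraMap_iff_spectrum_le hX).2 fun x hx => hb' (Set.mem_insert_of_mem _ hx)⟩

end SpectralOrder

theorem StarSubalgebra.spectrum_real_coe {A : Type*} [CStarAlgebra A] (S : StarSubalgebra ℂ A)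
    [IsClosed (S : Set A)] (x : S) : spectrum ℝ (x : A) = spectrum ℝ x := by
  rw [← spectrum.preimage_algebraMap ℂ, ← spectrum.preimage_algebraMap (R := ℝ) ℂ (a := x),
    StarSubalgebra.spectrum_eq (S := S)]

theorem StarSubalgebra.coe_cfc {A : Type*} [CStarAlgebra A] (S : StarSubalgebra ℂ A)
    [IsClosed (S : Set A)] {x : S} (hx : IsSelfAdjoint x) {f : ℝ → ℝ}
    (hf : ContinuousOn f (spectrum ℝ x)) : ((cfc f x : S) : A) = cfc f (x : A) :=
  StarAlgHom.map_cfc S.subtype f x hf continuous_subtype_val hx (hx.map S.subtype)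

/-! ### Jensen's inequality for compression by an isometry -/

section Compression

variable {K L : Type u} [NormedAddCommGroup K] [InnerProductSpace ℂ K] [CompleteSpace K]
  [NormedAddCommGroup L] [InnerProductSpace ℂ L] [CompleteSpace L]

/-- Conjugation by an isometry is multiplicative on the commutant of its range projection. -/
noncomputable def compressionHom (V : K →L[ℂ] L) (hV : adjoint V ∘L V = 1) :
    StarSubalgebra.centralizer ℂ ({V ∘L adjoint V} : Set (L →L[ℂ] L)) →⋆ₐ[ℂ] (K →L[ℂ] K) where
  toFun Y := adjoint V ∘L (Y : L →L[ℂ] L) ∘L V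
  map_one' := hV
  map_mul' Y Z := by
    have hZ := (StarSubalgebra.mem_centralizer_iff (R := ℂ)).1 Z.2 _ rfl
    ext ξ
    have h1 := congrArg (fun W : L →L[ℂ] L => W (V ξ)) hZ.1
    have h2 : adjoint V (V ξ) = ξ := congrArg (fun W : K →L[ℂ] K => W ξ) hV
    simp only [mul_apply_eq_comp, ContinuousLinearMap.comp_apply, h2] at h1
    simp [h1]
  map_zero' := by ext; simp
  map_add' Y Z := by ext; simp
  commutes' c := by
    ext ξ
    have h2 : adjoint V (V ξ) = ξ := congrArg (fun W : K →L[ℂ] K => W ξ) hV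
    simp [Algebra.algebraMap_eq_smul_one, h2]
  map_star' Y := by
    simp only [StarMemClass.coe_star, star_eq_adjoint, adjoint_comp, adjoint_adjoint]
    rfl

/-- The commutant of the projection `VV*` is a closed star subalgebra on which compression is a star
homomorphism, and continuous star homomorphisms commute with the functional calculus. -/
theorem cfc_compression (V : K →L[ℂ] L) (hV : adjoint V ∘L V = 1) (Y : L →L[ℂ] L)
    (hY : IsSelfAdjoint Y) (hc : Commute (V ∘L adjoint V) Y) (f : ℝ → ℝ)
    (hf : ContinuousOn f (spectrum ℝ Y)) :
    cfc f (adjoint V ∘L Y ∘L V) = adjoint V ∘L cfc f Y ∘L V := by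
  set S := StarSubalgebra.centralizer ℂ ({V ∘L adjoint V} : Set (L →L[ℂ] L)) with hS
  have : IsClosed (S : Set (L →L[ℂ] L)) := Set.isClosed_centralizer _
  have hP : star (V ∘L adjoint V) = V ∘L adjoint V := by
    rw [star_eq_adjoint, adjoint_comp, adjoint_adjoint]
  have hYS : Y ∈ S := by
    rw [hS, StarSubalgebra.mem_centralizer_iff]
    rintro _ rfl
    rw [hP]
    exact ⟨hc, hc⟩
  let y : S := ⟨Y, hYS⟩
  have hy : IsSelfAdjoint y := Subtype.ext hY
  have hsp : spectrum ℝ y = spectrum ℝ Y := (S.spectrum_real_coe y).symm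
  have h1 : ((cfc f y : S) : L →L[ℂ] L) = cfc f Y := S.coe_cfc hy (by rwa [hsp])
  have hcont : Continuous (compressionHom V hV) := by
    change Continuous fun Z : S => adjoint V ∘L (Z : L →L[ℂ] L) ∘L V
    fun_prop
  have h2 := StarAlgHom.map_cfc (compressionHom V hV) f y (by rwa [hsp]) hcont hy
    (hy.map (compressionHom V hV))
  rw [← h1]
  exact h2.symm

/-- Operator convexity for an operator and its image under a reflection. -/
theorem OperatorConvexOn.cfc_reflection_le {J : Set ℝ} {f : ℝ → ℝ}
    (hf : OperatorConvexOn.{u} J f) {U X : L →L[ℂ] L} (hUs : IsSelfAdjoint U) (hUU : U * U = 1)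
    (hX : IsSelfAdjoint X) (hXJ : spectrum ℝ X ⊆ J) {x₀ : ℝ} (hx₀ : x₀ ∈ J) :
    spectrum ℝ ((1 / 2 : ℝ) • X + (1 - 1 / 2 : ℝ) • (U * X * U)) ⊆ J ∧
      cfc f ((1 / 2 : ℝ) • X + (1 - 1 / 2 : ℝ) • (U * X * U)) ≤
        (1 / 2 : ℝ) • cfc f X + (1 - 1 / 2 : ℝ) • (U * cfc f X * U) := by
  obtain ⟨a, haJ, b, hbJ, ha, hb⟩ := exists_algebraMap_le_and_le hx₀ hX hXJ
  have hX' : IsSelfAdjoint (U * X * U) := hX.conjugate_self hUs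
  have hcon : ∀ c : ℝ, U * algebraMap ℝ (L →L[ℂ] L) c * U = algebraMap ℝ (L →L[ℂ] L) c :=
    fun c => by rw [← Algebra.commutes, mul_assoc, hUU, mul_one]
  have ha' : algebraMap ℝ (L →L[ℂ] L) a ≤ U * X * U := hcon a ▸ hUs.conjugate_le_conjugate ha
  have hb' : U * X * U ≤ algebraMap ℝ (L →L[ℂ] L) b := hcon b ▸ hUs.conjugate_le_conjugate hb
  have hIcc : Set.Icc a b ⊆ J := hf.1.out haJ hbJ
  have hX'J : spectrum ℝ (U * X * U) ⊆ J := (spectrum_subset_Icc_of_le hX' ha' hb').trans hIcc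
  have hfX' : cfc f (U * X * U) = U * cfc f X * U := by
    have hUa : adjoint U = U := hUs
    have hU1 : U ∘L U = 1 := hUU
    have := cfc_compression U (by rw [hUa, hU1]) X hX (by rw [hUa, hU1]; exact .one_left X) f
      (hf.2.1.mono hXJ)
    rw [hUa] at this
    exact this
  have hmid : ∀ Z : L →L[ℂ] L, (1 / 2 : ℝ) • Z + (1 - 1 / 2 : ℝ) • Z = Z := fun Z => by
    rw [← add_smul, add_sub_cancel, one_smul]
  refine ⟨?_, ?_⟩
  · refine (spectrum_subset_Icc_of_le ((hX.real_smul _).add (hX'.real_smul _))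
      (a := a) (b := b) ?_ ?_).trans hIcc
    · rw [← hmid (algebraMap ℝ (L →L[ℂ] L) a)]
      exact add_le_add (smul_le_smul_of_nonneg_left ha (by norm_num))
        (smul_le_smul_of_nonneg_left ha' (by norm_num))
    · rw [← hmid (algebraMap ℝ (L →L[ℂ] L) b)]
      exact add_le_add (smul_le_smul_of_nonneg_left hb (by norm_num))
        (smul_le_smul_of_nonneg_left hb' (by norm_num))
  · rw [← hfX']
    exact hf.2.2 L X (U * X * U) hX hX' hXJ hX'J (1 / 2) (by norm_num) (by norm_num)

/-- The operator Jensen inequality for an isometry. -/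
theorem OperatorConvexOn.cfc_compression_le {J : Set ℝ} {f : ℝ → ℝ}
    (hf : OperatorConvexOn.{u} J f) (V : K →L[ℂ] L) (hV : adjoint V ∘L V = 1) {X : L →L[ℂ] L}
    (hX : IsSelfAdjoint X) (hXJ : spectrum ℝ X ⊆ J) {x₀ : ℝ} (hx₀ : x₀ ∈ J) :
    cfc f (adjoint V ∘L X ∘L V) ≤ adjoint V ∘L cfc f X ∘L V := by
  have hVV : ∀ ξ, adjoint V (V ξ) = ξ := fun ξ => congrArg (fun W : K →L[ℂ] K => W ξ) hV
  obtain ⟨P, hP⟩ : ∃ P : L →L[ℂ] L, P = V ∘L adjoint V := ⟨_, rfl⟩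
  have hPP : P * P = P := by ext ξ; simp [hP, hVV]
  have hPs : IsSelfAdjoint P := by
    rw [IsSelfAdjoint, star_eq_adjoint, hP, adjoint_comp, adjoint_adjoint]
  -- This reflection fixes the range of `V`, so compression does not distinguish `Z` from `UZU`,
  -- while the average of the two commutes with `P`.
  obtain ⟨U, hU⟩ : ∃ U : L →L[ℂ] L, U = P + P - 1 := ⟨_, rfl⟩
  have hUs : IsSelfAdjoint U := hU ▸ (hPs.add hPs).sub (.one _)
  have hUU : U * U = 1 := by
    rw [hU]
    simp only [mul_sub, sub_mul, mul_add, add_mul, mul_one, one_mul, hPP]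
    abel
  have hUV : ∀ ξ, U (V ξ) = V ξ := fun ξ => by simp [hU, hP, hVV]
  have hVU : ∀ ξ, adjoint V (U ξ) = adjoint V ξ := fun ξ => by simp [hU, hP, hVV]
  obtain ⟨hYJ, hconv⟩ := hf.cfc_reflection_le hUs hUU hX hXJ hx₀
  have hcomp : ∀ Z : L →L[ℂ] L, adjoint V ∘L ((1 / 2 : ℝ) • Z + (1 - 1 / 2 : ℝ) • (U * Z * U)) ∘L V
      = adjoint V ∘L Z ∘L V := fun Z => by
    ext ξ
    simp only [ContinuousLinearMap.comp_apply, add_apply, smul_apply, mul_apply_eq_comp, map_add,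
      hUV, hVU, map_smul_of_tower]
    rw [← add_smul, add_sub_cancel, one_smul]
  have hYs : IsSelfAdjoint ((1 / 2 : ℝ) • X + (1 - 1 / 2 : ℝ) • (U * X * U)) :=
    (hX.real_smul _).add ((hX.conjugate_self hUs).real_smul _)
  have hcU : Commute U ((1 / 2 : ℝ) • X + (1 - 1 / 2 : ℝ) • (U * X * U)) := by
    have h1 : U * (U * X * U) = X * U := by rw [← mul_assoc, ← mul_assoc, hUU, one_mul]
    have h2 : U * X * U * U = U * X := by rw [mul_assoc, hUU, mul_one]
    have h3 : (1 - 1 / 2 : ℝ) = 1 / 2 := by norm_num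
    rw [Commute, SemiconjBy, h3]
    simp only [mul_add, add_mul, mul_smul_comm, smul_mul_assoc, h1, h2]
    exact add_comm _ _
  have hc : Commute P ((1 / 2 : ℝ) • X + (1 - 1 / 2 : ℝ) • (U * X * U)) := by
    have hP2 : P = (1 / 2 : ℝ) • (U + 1) := by
      rw [hU, sub_add_cancel, ← two_smul ℝ P, smul_smul, one_div, inv_mul_cancel₀ two_ne_zero,
        one_smul]
    rw [hP2]
    exact (Commute.add_left hcU (Commute.one_left _)).smul_left _
  rw [hP] at hc
  rw [← hcomp X, cfc_compression V hV _ hYs hc f (hf.2.1.mono hYJ), ← hcomp (cfc f X)]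
  have := (nonneg_iff_isPositive _).1 (sub_nonneg.2 hconv)
  rw [← sub_nonneg, nonneg_iff_isPositive, ← comp_sub, ← sub_comp]
  exact this.adjoint_conj V

end Compression

/-! ### Jensen's inequality for a finite resolution of the identity -/

section Diagonal

variable {K : Type u} [NormedAddCommGroup K] [InnerProductSpace ℂ K] [CompleteSpace K] {n : ℕ}

/-- The diagonal operator with the scalars `c i` on the diagonal. -/
noncomputable def diagOp (K : Type u) [NormedAddCommGroup K] [InnerProductSpace ℂ K]
    [CompleteSpace K] {n : ℕ} (c : Fin n → ℂ) :
    PiLp 2 (fun _ : Fin n => K) →L[ℂ] PiLp 2 (fun _ : Fin n => K) :=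
  ((PiLp.continuousLinearEquiv 2 ℂ (fun _ : Fin n => K)).symm : _ →L[ℂ] _) ∘L
    ContinuousLinearMap.pi fun i => c i • PiLp.proj 2 (𝕜 := ℂ) (fun _ : Fin n => K) i

theorem diagOp_apply (c : Fin n → ℂ) (v : PiLp 2 (fun _ : Fin n => K)) (i : Fin n) :
    diagOp K c v i = c i • v i := rfl

/-- Diagonal operators as a star homomorphism. -/
noncomputable def diagHom (K : Type u) [NormedAddCommGroup K] [InnerProductSpace ℂ K]
    [CompleteSpace K] (n : ℕ) :
    (Fin n → ℂ) →⋆ₐ[ℂ] (PiLp 2 (fun _ : Fin n => K) →L[ℂ] PiLp 2 (fun _ : Fin n => K)) where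
  toFun := diagOp K
  map_one' := by ext v i; simp [diagOp_apply]
  map_mul' c d := by ext v i; simp [diagOp_apply, mul_smul]
  map_zero' := by ext v i; simp [diagOp_apply]
  map_add' c d := by ext v i; simp [diagOp_apply, add_smul]
  commutes' c := by ext v i; simp [diagOp_apply, Algebra.algebraMap_eq_smul_one]
  map_star' c := by
    rw [star_eq_adjoint, eq_adjoint_iff]
    intro v w
    simp [PiLp.inner_apply, diagOp_apply, inner_smul_left, inner_smul_right]

/-- The column operator with entries `R i`. -/
noncomputable def columnOp (R : Fin n → K →L[ℂ] K) : K →L[ℂ] PiLp 2 (fun _ : Fin n => K) :=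
  ((PiLp.continuousLinearEquiv 2 ℂ (fun _ : Fin n => K)).symm : _ →L[ℂ] _) ∘L
    ContinuousLinearMap.pi R

omit [CompleteSpace K] in
theorem columnOp_apply (R : Fin n → K →L[ℂ] K) (ξ : K) (i : Fin n) : columnOp R ξ i = R i ξ := rfl

theorem adjoint_columnOp_diagOp (R : Fin n → K →L[ℂ] K) (c : Fin n → ℂ) :
    adjoint (columnOp R) ∘L diagOp K c ∘L columnOp R = ∑ i, c i • (star (R i) * R i) := by
  ext ξ
  refine ext_inner_left ℂ fun η => ?_
  simp [adjoint_inner_right, PiLp.inner_apply, diagOp_apply, columnOp_apply, inner_sum,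
    inner_smul_right, star_eq_adjoint]

theorem spectrum_diagHom_subset (x : Fin n → ℝ) :
    spectrum ℝ (diagHom K n fun i => (x i : ℂ)) ⊆ Set.range x := by
  refine (AlgHom.spectrum_apply_subset ((diagHom K n).toAlgHom.restrictScalars ℝ) _).trans ?_
  rw [Pi.spectrum_eq]
  refine Set.iUnion_subset fun i y hy => ?_
  have : spectrum ℝ ((x i : ℂ)) = spectrum ℝ (algebraMap ℝ ℂ (x i)) := rfl
  rw [this, spectrum.scalar_eq] at hy
  exact ⟨i, hy.symm⟩

theorem cfc_diagHom (x : Fin n → ℝ) (f : ℝ → ℝ) :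
    cfc f (diagHom K n fun i => (x i : ℂ)) = diagHom K n fun i => (f (x i) : ℂ) := by
  classical
  have hx : IsSelfAdjoint (fun i => (x i : ℂ)) := by
    ext i; simp
  -- The spectrum is finite, so `f` agrees there with a polynomial and needs no continuity. The
  -- image finset removes repeated nodes.
  set p := Lagrange.interpolate (Finset.univ.image x) id f with hp
  have hpx : ∀ i, p.eval (x i) = f (x i) := fun i =>
    Lagrange.eval_interpolate_at_node f (Set.injOn_id _)
      (Finset.mem_image_of_mem x (Finset.mem_univ i))
  have heq : (spectrum ℝ (diagHom K n fun i => (x i : ℂ))).EqOn f p.eval := fun y hy => by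
    obtain ⟨i, rfl⟩ := spectrum_diagHom_subset x hy
    exact (hpx i).symm
  rw [cfc_congr heq, cfc_polynomial p _ (hx.map (diagHom K n))]
  refine (Polynomial.aeval_algHom_apply ((diagHom K n).toAlgHom.restrictScalars ℝ) _ p).trans ?_
  refine congrArg (diagHom K n) (funext fun i => ?_)
  rw [← hpx i]
  refine (Polynomial.aeval_algHom_apply (Pi.evalAlgHom ℝ (fun _ : Fin n => ℂ) i) _ p).symm.trans ?_
  exact Polynomial.aeval_algebraMap_apply ℂ (x i) p

/-- The Jensen inequality for an operator convex function and a finite resolution of the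
identity. -/
theorem OperatorConvexOn.cfc_sum_le {J : Set ℝ} {f : ℝ → ℝ} (hf : OperatorConvexOn.{u} J f)
    (E : Fin n → K →L[ℂ] K) (hE : ∀ i, 0 ≤ E i) (hE1 : ∑ i, E i = 1) (x : Fin n → ℝ)
    (hx : ∀ i, x i ∈ J) {x₀ : ℝ} (hx₀ : x₀ ∈ J) :
    cfc f (∑ i, x i • E i) ≤ ∑ i, f (x i) • E i := by
  -- With these entries the column `V` satisfies `V*V = ∑ Eᵢ = 1` and `V* diag(c) V = ∑ cᵢ Eᵢ`.
  set R : Fin n → K →L[ℂ] K := fun i => CFC.sqrt (E i)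
  have hR : ∀ i, star (R i) * R i = E i := fun i => by
    have : IsSelfAdjoint (R i) := IsSelfAdjoint.of_nonneg (CFC.sqrt_nonneg _)
    rw [this.star_eq]
    exact CFC.sqrt_mul_sqrt_self _ (hE i)
  have key : ∀ c : Fin n → ℝ, adjoint (columnOp R) ∘L diagHom K n (fun i => (c i : ℂ)) ∘L
      columnOp R = ∑ i, c i • E i := fun c => by
    refine (adjoint_columnOp_diagOp R _).trans ?_
    simp [hR]
  have hV : adjoint (columnOp R) ∘L columnOp R = 1 := by
    have := adjoint_columnOp_diagOp R 1
    simp only [hR, Pi.one_apply, one_smul, hE1] at this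
    exact this ▸ congrArg (fun W => adjoint (columnOp R) ∘L W) (by ext; simp [diagOp_apply])
  have hXs : IsSelfAdjoint (diagHom K n fun i => (x i : ℂ)) := by
    refine IsSelfAdjoint.map ?_ _
    ext i; simp
  have hXJ : spectrum ℝ (diagHom K n fun i => (x i : ℂ)) ⊆ J := by
    refine (spectrum_diagHom_subset x).trans ?_
    rintro _ ⟨i, rfl⟩
    exact hx i
  have := hf.cfc_compression_le (columnOp R) hV hXs hXJ hx₀
  rwa [cfc_diagHom, key, key] at this

end Diagonal

section Norm

variable {A : Type*} [CStarAlgebra A] [PartialOrder A] [StarOrderedRing A]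

theorem norm_le_of_algebraMap_le {X : A} {c : ℝ} (hc : 0 ≤ c) (hX : IsSelfAdjoint X)
    (h1 : algebraMap ℝ A (-c) ≤ X) (h2 : X ≤ algebraMap ℝ A c) : ‖X‖ ≤ c := by
  rw [← cfc_id' ℝ X hX]
  exact norm_cfc_le hc fun x hx => abs_le.2 (spectrum_subset_Icc_of_le hX h1 h2 hx)

end Norm

/-! ### Norm continuity of the functional calculus -/

section CfcContinuity

/-- Gives a compact neighbourhood relative to `J` when `J` may or may not contain its endpoints:
either `J` has a point beyond `M`, or `M` is its maximum. -/
theorem exists_mem_forall_lt_le {J : Set ℝ} {M : ℝ} (hM : M ∈ J) :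
    ∃ β ∈ J, ∃ β', M < β' ∧ M ≤ β ∧ ∀ x ∈ J, x < β' → x ≤ β := by
  by_cases h : ∃ y ∈ J, M < y
  · obtain ⟨y, hy, hMy⟩ := h
    exact ⟨y, hy, y, hMy, hMy.le, fun x _ hx => hx.le⟩
  · push Not at h
    exact ⟨M, hM, M + 1, by linarith, le_rfl, fun x hx _ => h x hx⟩

theorem exists_mem_forall_lt_ge {J : Set ℝ} {m : ℝ} (hm : m ∈ J) :
    ∃ α ∈ J, ∃ α', α' < m ∧ α ≤ m ∧ ∀ x ∈ J, α' < x → α ≤ x := by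
  by_cases h : ∃ y ∈ J, y < m
  · obtain ⟨y, hy, hMy⟩ := h
    exact ⟨y, hy, y, hMy, hMy.le, fun x _ hx => hx.le⟩
  · push Not at h
    exact ⟨m, hm, m - 1, by linarith, le_rfl, fun x hx _ => h x hx⟩

variable {A : Type*} [CStarAlgebra A]

/-- The continuous functional calculus is continuous on the self-adjoint elements with spectrum in
an interval. -/
theorem continuousOn_cfc_of_ordConnected {J : Set ℝ} (hJ : J.OrdConnected) {f : ℝ → ℝ}
    (hf : ContinuousOn f J) :
    ContinuousOn (cfc f) {X : A | IsSelfAdjoint X ∧ spectrum ℝ X ⊆ J} := by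
  intro X hX
  have hcomp := ContinuousFunctionalCalculus.isCompact_spectrum (R := ℝ) (p := IsSelfAdjoint) X
  have key : ∃ s U : Set ℝ, IsCompact s ∧ s ⊆ J ∧ IsOpen U ∧ spectrum ℝ X ⊆ U ∧ U ∩ J ⊆ s := by
    rcases (spectrum ℝ X).eq_empty_or_nonempty with h | h
    · exact ⟨∅, ∅, isCompact_empty, Set.empty_subset _, isOpen_empty, h.subset, by simp⟩
    · obtain ⟨m, hm, hm'⟩ := hcomp.exists_isLeast h
      obtain ⟨M, hM, hM'⟩ := hcomp.exists_isGreatest h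
      obtain ⟨α, hα, α', hα', -, hα2⟩ := exists_mem_forall_lt_ge (hX.2 hm)
      obtain ⟨β, hβ, β', hβ', -, hβ2⟩ := exists_mem_forall_lt_le (hX.2 hM)
      exact ⟨Set.Icc α β, Set.Ioo α' β', isCompact_Icc, hJ.out hα hβ, isOpen_Ioo,
        fun x hx => ⟨hα'.trans_le (hm' hx), (hM' hx).trans_lt hβ'⟩,
        fun x hx => ⟨hα2 x hx.2 hx.1.1, hβ2 x hx.2 hx.1.2⟩⟩
  obtain ⟨s, U, hs, hsJ, hU, hXU, hUs⟩ := key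
  have hev : ∀ᶠ Y in 𝓝 X, spectrum ℝ Y ⊆ U :=
    ((upperHemicontinuous_spectrum ℝ A).upperHemicontinuousAt X U
      (hU.mem_nhdsSet.2 hXU)).mono fun Y hY => subset_of_mem_nhdsSet hY
  refine ContinuousWithinAt.cfc hs f hX continuousWithinAt_id ?_ ?_ (hf.mono hsJ)
  · filter_upwards [nhdsWithin_le_nhds hev, self_mem_nhdsWithin] with Y h1 h2
    exact fun x hx => hUs ⟨h1 hx, h2.2 hx⟩
  · filter_upwards [self_mem_nhdsWithin] with Y h2 using h2.1

theorem IsContinuousField.continuous_cfc {T : Type*} [TopologicalSpace T] {J : Set ℝ} {X : T → A}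
    (hX : IsContinuousField J X) (hJ : J.OrdConnected) {f : ℝ → ℝ} (hf : ContinuousOn f J) :
    Continuous fun t => cfc f (X t) :=
  (continuousOn_cfc_of_ordConnected hJ hf).comp_continuous hX.1 hX.2

end CfcContinuity

section SubalgebraOrder

variable {H : Type*} [NormedAddCommGroup H] [InnerProductSpace ℂ H] [CompleteSpace H]

/-- A norm closed star subalgebra of operators is ordered by its own squares. -/
theorem StarSubalgebra.starOrderedRing (S : StarSubalgebra ℂ (H →L[ℂ] H))
    [IsClosed (S : Set (H →L[ℂ] H))] : StarOrderedRing S := by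
  refine StarOrderedRing.of_nonneg_iff' (fun {x y} h z => add_le_add_right (α := H →L[ℂ] H) h z)
    fun x => ⟨fun h => ?_, ?_⟩
  · have hx : IsSelfAdjoint x := Subtype.ext (IsSelfAdjoint.of_nonneg (R := H →L[ℂ] H) h)
    have hsp : ∀ r ∈ spectrum ℝ x, 0 ≤ r := fun r hr =>
      spectrum_nonneg_of_nonneg (A := H →L[ℂ] H) h ((S.spectrum_real_coe x).symm ▸ hr)
    have hcont : ContinuousOn Real.sqrt (spectrum ℝ x) := Real.continuous_sqrt.continuousOn
    -- The root is formed inside `S`; spectral permanence makes the spectrum there nonnegative.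
    refine ⟨cfc Real.sqrt x, ?_⟩
    rw [(cfc_predicate Real.sqrt x : IsSelfAdjoint _).star_eq, ← cfc_mul _ _ x hcont hcont]
    conv_lhs => rw [← cfc_id' ℝ x hx]
    exact cfc_congr fun r hr => (Real.mul_self_sqrt (hsp r hr)).symm
  · rintro ⟨s, rfl⟩
    exact star_mul_self_nonneg (s : H →L[ℂ] H)

end SubalgebraOrder

/-! ### Jensen's inequality for positive maps on continuous functions -/

section Bernstein

open unitInterval

theorem sum_bernstein_smul_z {n : ℕ} (hn : n ≠ 0) (s : I) :
    ∑ k : Fin (n + 1), bernstein n k s * (bernstein.z k : ℝ) = s := by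
  have h := congrArg (Polynomial.aeval (s : ℝ)) (bernsteinPolynomial.sum_smul ℝ n)
  have hn' : (n : ℝ) ≠ 0 := Nat.cast_ne_zero.2 hn
  have h' : ∑ k : Fin (n + 1), (k : ℝ) * bernstein n k s = n * s := by
    simpa [Finset.sum_range, bernstein, Polynomial.toContinuousMapOn,
      Polynomial.toContinuousMap] using h
  rw [← mul_right_inj' hn', ← h', Finset.mul_sum]
  refine Finset.sum_congr rfl fun k _ => ?_
  simp only [bernstein.z]
  field_simp

variable {K : Type u} [NormedAddCommGroup K] [InnerProductSpace ℂ K] [CompleteSpace K]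

theorem norm_map_le_of_positive (P : C(I, ℝ) →ₗ[ℝ] (K →L[ℂ] K)) (hP : ∀ g, 0 ≤ g → 0 ≤ P g)
    (hP1 : P 1 = 1) (g : C(I, ℝ)) : ‖P g‖ ≤ ‖g‖ := by
  have hal : ∀ c : ℝ, algebraMap ℝ (K →L[ℂ] K) c = P (c • 1) := fun c => by
    rw [map_smul, hP1, Algebra.algebraMap_eq_smul_one]
  have h1 : algebraMap ℝ (K →L[ℂ] K) (-‖g‖) ≤ P g := by
    rw [hal, ← sub_nonneg, ← map_sub]
    exact hP _ fun s => by
      simpa using neg_le_iff_add_nonneg.1 (neg_le_of_abs_le (g.norm_coe_le_norm s))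
  have h2 : P g ≤ algebraMap ℝ (K →L[ℂ] K) ‖g‖ := by
    rw [hal, ← sub_nonneg, ← map_sub]
    exact hP _ fun s => by simpa using le_of_abs_le (g.norm_coe_le_norm s)
  refine norm_le_of_algebraMap_le (norm_nonneg _) ?_ h1 h2
  have := (IsSelfAdjoint.of_nonneg (sub_nonneg.2 h1)).add
    (IsSelfAdjoint.algebraMap (K →L[ℂ] K) (IsSelfAdjoint.all (-‖g‖)))
  rwa [sub_add_cancel] at this

/-- The Jensen inequality for an operator convex function and a unital positive linear map on the
continuous functions on the unit interval, the interval being mapped affinely to `[a, b]`. -/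
theorem OperatorConvexOn.cfc_map_le {J : Set ℝ} {f : ℝ → ℝ} (hf : OperatorConvexOn.{u} J f)
    (P : C(I, ℝ) →ₗ[ℝ] (K →L[ℂ] K)) (hP : ∀ g, 0 ≤ g → 0 ≤ P g) (hP1 : P 1 = 1)
    {a b : ℝ} {F G : C(I, ℝ)} (hG : ∀ s : I, G s = a + (b - a) * s) (hGJ : ∀ s, G s ∈ J)
    (hF : ∀ s, F s = f (G s)) : cfc f (P G) ≤ P F := by
  have happ : ∀ (n : ℕ) (g : C(I, ℝ)), P (bernsteinApproximation n g) =
      ∑ k : Fin (n + 1), g (bernstein.z k) • P (bernstein n k) := fun n g => by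
    simp only [← map_smul]
    rw [← map_sum]
    congr 1
    ext s
    simp [bernsteinApproximation.apply, mul_comm]
  have hcont : Continuous P :=
    (LinearMap.mkContinuous P 1 fun g => by
      simpa using norm_map_le_of_positive P hP hP1 g).continuous
  refine ge_of_tendsto ((hcont.tendsto F).comp (bernsteinApproximation_uniform F)) ?_
  filter_upwards [eventually_ne_atTop 0] with n hn
  have h1 : ∑ k : Fin (n + 1), P (bernstein n k) = 1 := by
    rw [← map_sum, ← hP1]
    congr 1
    ext s
    simp
  -- Since `G` is affine, it is reproduced exactly, so only the right-hand side varies with `n`.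
  have hGn : bernsteinApproximation n G = G := by
    ext s
    simp only [bernsteinApproximation.apply, hG, smul_eq_mul, mul_add, Finset.sum_add_distrib,
      ← Finset.sum_mul, bernstein.probability, one_mul]
    rw [← sum_bernstein_smul_z hn s, Finset.mul_sum]
    congr 1
    exact Finset.sum_congr rfl fun k _ => by ring
  have := hf.cfc_sum_le (fun k : Fin (n + 1) => P (bernstein n k))
    (fun k => hP _ fun s => bernstein_nonneg) h1 (fun k => G (bernstein.z k)) (fun k => hGJ _)
    (hGJ 0)
  simp only [← hF] at this
  rwa [← happ, ← happ, hGn] at this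

end Bernstein

theorem Set.OrdConnected.exists_exhaustion {J : Set ℝ} (hJ : J.OrdConnected) {x₀ : ℝ}
    (hx₀ : x₀ ∈ J) : ∃ a b : ℕ → ℝ, Antitone a ∧ Monotone b ∧ (∀ n, a n ∈ J) ∧ (∀ n, b n ∈ J) ∧
      ∀ x ∈ J, ∀ᶠ n in atTop, x ∈ Set.Icc (a n) (b n) := by
  have := hJ
  have : Nonempty J := ⟨⟨x₀, hx₀⟩⟩
  obtain ⟨b, hb, hb'⟩ := exists_seq_monotone_tendsto_atTop_atTop J
  obtain ⟨a, ha, ha'⟩ := exists_seq_antitone_tendsto_atTop_atBot J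
  refine ⟨fun n => a n, fun n => b n, fun i j h => ha h, fun i j h => hb h, fun n => (a n).2,
    fun n => (b n).2, fun x hx => ?_⟩
  filter_upwards [ha'.eventually_le_atBot ⟨x, hx⟩, hb'.eventually_ge_atTop ⟨x, hx⟩] with n h1 h2
  exact ⟨h1, h2⟩

/-! ### Subunital fields and the spectrum of their integrals -/

section PositiveField

variable {A B : Type*} [CStarAlgebra A] [PartialOrder A] [StarOrderedRing A]
  [CStarAlgebra B] [PartialOrder B] [StarOrderedRing B]
  {T : Type*} [TopologicalSpace T] [MeasurableSpace T]

/-- A field of positive real-linear maps that sends continuous fields of self-adjoint elements to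
measurable fields, and the integral of whose values at `1` is at most `1`. -/
structure IsSubunitalField (μ : Measure T) (Ψ : T → A →ₗ[ℝ] B) : Prop where
  nonneg : ∀ t a, 0 ≤ a → 0 ≤ Ψ t a
  aestronglyMeasurable : ∀ Z : T → A, Continuous Z → (∀ t, IsSelfAdjoint (Z t)) →
    AEStronglyMeasurable (fun t => Ψ t (Z t)) μ
  integrable_one : Integrable (fun t => Ψ t 1) μ
  integral_one_le : ∫ t, Ψ t 1 ∂μ ≤ 1

theorem LinearMap.mono_of_nonneg {φ : A →ₗ[ℝ] B} (hφ : ∀ a, 0 ≤ a → 0 ≤ φ a) {X Y : A}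
    (h : X ≤ Y) : φ X ≤ φ Y := by
  rw [← sub_nonneg, ← map_sub]
  exact hφ _ (sub_nonneg.2 h)

omit [PartialOrder A] [StarOrderedRing A] [PartialOrder B] [StarOrderedRing B] in
theorem LinearMap.map_algebraMap_real (φ : A →ₗ[ℝ] B) (c : ℝ) : φ (algebraMap ℝ A c) = c • φ 1 := by
  rw [Algebra.algebraMap_eq_smul_one, map_smul]

/-- Write `φ X = ‖X‖ φ(1) - φ(‖X‖ - X)`, a difference of positive elements. -/
theorem LinearMap.isSelfAdjoint_of_nonneg {φ : A →ₗ[ℝ] B} (hφ : ∀ a, 0 ≤ a → 0 ≤ φ a) {X : A}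
    (hX : IsSelfAdjoint X) : IsSelfAdjoint (φ X) := by
  have h1 := IsSelfAdjoint.of_nonneg
    (hφ _ (sub_nonneg.2 (IsSelfAdjoint.le_algebraMap_norm_self (a := X) hX)))
  have h2 := (IsSelfAdjoint.of_nonneg (hφ 1 zero_le_one)).real_smul ‖X‖
  rw [map_sub, LinearMap.map_algebraMap_real] at h1
  have := h2.sub h1
  rwa [sub_sub_cancel] at this

theorem LinearMap.norm_map_le_of_nonneg {φ : A →ₗ[ℝ] B} (hφ : ∀ a, 0 ≤ a → 0 ≤ φ a) {X : A}
    (hX : IsSelfAdjoint X) : ‖φ X‖ ≤ ‖X‖ * ‖φ 1‖ := by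
  have h1 : φ 1 ≤ algebraMap ℝ B ‖φ 1‖ :=
    IsSelfAdjoint.le_algebraMap_norm_self (IsSelfAdjoint.of_nonneg (hφ 1 zero_le_one))
  have h2 : ‖X‖ • φ 1 ≤ algebraMap ℝ B (‖X‖ * ‖φ 1‖) := by
    rw [map_mul, ← Algebra.smul_def]
    exact smul_le_smul_of_nonneg_left h1 (norm_nonneg _)
  refine norm_le_of_algebraMap_le (by positivity) (isSelfAdjoint_of_nonneg hφ hX) ?_ ?_
  · rw [map_neg, neg_le]
    refine le_trans ?_ h2
    rw [neg_le, ← LinearMap.map_algebraMap_real, ← map_neg]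
    exact mono_of_nonneg hφ (IsSelfAdjoint.neg_algebraMap_norm_le_self (a := X) hX)
  · refine le_trans ?_ h2
    rw [← LinearMap.map_algebraMap_real]
    exact mono_of_nonneg hφ (IsSelfAdjoint.le_algebraMap_norm_self (a := X) hX)

omit [TopologicalSpace T] [PartialOrder B] [StarOrderedRing B] in
theorem isSelfAdjoint_integral {μ : Measure T} {F : T → B} (hF : ∀ t, IsSelfAdjoint (F t)) :
    IsSelfAdjoint (∫ t, F t ∂μ) := by
  by_cases hi : Integrable F μ
  · have := (starL' ℝ : B ≃L[ℝ] B).toContinuousLinearMap.integral_comp_comm hi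
    refine this.symm.trans (integral_congr_ae (.of_forall fun t => hF t))
  · rw [integral_undef hi]
    exact .zero B

namespace IsSubunitalField

variable {μ : Measure T} {Ψ : T → A →ₗ[ℝ] B}

theorem integrable_of_norm_le (hΨ : IsSubunitalField μ Ψ) {Z : T → A} (hZ : Continuous Z)
    (hZs : ∀ t, IsSelfAdjoint (Z t)) {C : ℝ} (hC : ∀ t, ‖Z t‖ ≤ C) :
    Integrable (fun t => Ψ t (Z t)) μ := by
  refine (hΨ.integrable_one.norm.const_mul C).mono' (hΨ.aestronglyMeasurable Z hZ hZs)
    (.of_forall fun t => ?_)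
  exact (LinearMap.norm_map_le_of_nonneg (hΨ.nonneg t) (hZs t)).trans
    (mul_le_mul_of_nonneg_right (hC t) (norm_nonneg _))

theorem restrict (hΨ : IsSubunitalField μ Ψ) (s : Set T) :
    IsSubunitalField (μ.restrict s) Ψ where
  nonneg := hΨ.nonneg
  aestronglyMeasurable Z hZ hZs := (hΨ.aestronglyMeasurable Z hZ hZs).restrict
  integrable_one := hΨ.integrable_one.restrict
  integral_one_le := (integral_mono_measure Measure.restrict_le_self
    (.of_forall fun t => hΨ.nonneg t 1 zero_le_one) hΨ.integrable_one).trans hΨ.integral_one_le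

/-- The integral of a field of strictly positive elements, completed by a positive multiple of the
defect of the field, is bounded below. -/
theorem exists_algebraMap_le [OpensMeasurableSpace T] (hΨ : IsSubunitalField μ Ψ) {Z : T → A}
    (hZ : Continuous Z) (hZpos : ∀ t, ∃ c : ℝ, 0 < c ∧ algebraMap ℝ A c ≤ Z t)
    (hZi : Integrable (fun t => Ψ t (Z t)) μ) {z₀ : ℝ} (hz₀ : 0 < z₀) :
    ∃ c : ℝ, 0 < c ∧
      algebraMap ℝ B c ≤ (∫ t, Ψ t (Z t) ∂μ) + z₀ • (1 - ∫ t, Ψ t 1 ∂μ) := by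
  -- The lower bound on `Z t` is not uniform in `t`, so `T` is exhausted by sets where it is.
  set s : ℕ → Set T := fun n => {t | algebraMap ℝ A (1 / ((n : ℝ) + 1)) ≤ Z t} with hs
  have hsm : ∀ n, MeasurableSet (s n) := fun n =>
    (isClosed_le continuous_const hZ).measurableSet
  have hmono : Monotone s := fun m n hmn t ht =>
    (algebraMap_mono A (Nat.one_div_le_one_div hmn)).trans ht
  have hU : ⋃ n, s n = Set.univ := Set.eq_univ_of_forall fun t => by
    obtain ⟨c, hc, hct⟩ := hZpos t
    obtain ⟨n, hn⟩ := exists_nat_one_div_lt hc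
    exact Set.mem_iUnion.2 ⟨n, (algebraMap_mono A hn.le).trans hct⟩
  have hlim := tendsto_setIntegral_of_monotone hsm hmono
    (hΨ.integrable_one.integrableOn (s := ⋃ n, s n))
  rw [hU, setIntegral_univ] at hlim
  -- With `c = 1/(n+1) ≤ z₀` and `‖S - Sₙ‖ < 1/2`, the sum is at least `c Sₙ + c (1 - S) = c (1 - (S
  -- - Sₙ)) ≥ c/2`.
  have h1 := (Metric.tendsto_nhds.1 hlim (1 / 2) (by norm_num)).and
    (tendsto_one_div_add_atTop_nhds_zero_nat.eventually_le_const hz₀)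
  obtain ⟨n, hn, hnz⟩ := h1.exists
  set c : ℝ := 1 / ((n : ℝ) + 1) with hc
  have hc0 : 0 < c := Nat.one_div_pos_of_nat
  set S := ∫ t, Ψ t 1 ∂μ with hS
  set Sₙ := ∫ t in s n, Ψ t 1 ∂μ with hSₙ
  have hZ0 : ∀ t, 0 ≤ Ψ t (Z t) := fun t => by
    obtain ⟨c, hc, hct⟩ := hZpos t
    refine hΨ.nonneg t _ (le_trans ?_ hct)
    rw [← map_zero (algebraMap ℝ A)]
    exact algebraMap_mono A hc.le
  have hA : c • Sₙ ≤ ∫ t, Ψ t (Z t) ∂μ := by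
    refine le_trans ?_ (integral_mono_measure (Measure.restrict_le_self (s := s n))
      (.of_forall hZ0) hZi)
    rw [hSₙ, ← integral_smul]
    refine integral_mono_ae (hΨ.integrable_one.restrict.smul c) hZi.restrict ?_
    filter_upwards [ae_restrict_mem (hsm n)] with t ht
    rw [← LinearMap.map_algebraMap_real]
    exact LinearMap.mono_of_nonneg (hΨ.nonneg t) ht
  have hB : c • (1 - S) ≤ z₀ • (1 - S) :=
    smul_le_smul_of_nonneg_right hnz (sub_nonneg.2 hΨ.integral_one_le)
  have hsa : IsSelfAdjoint (S - Sₙ) :=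
    (isSelfAdjoint_integral fun t => .of_nonneg (hΨ.nonneg t 1 zero_le_one)).sub
      (isSelfAdjoint_integral fun t => .of_nonneg (hΨ.nonneg t 1 zero_le_one))
  have hC : S - Sₙ ≤ algebraMap ℝ B (1 / 2) := by
    refine (IsSelfAdjoint.le_algebraMap_norm_self hsa).trans (algebraMap_mono B ?_)
    rw [← dist_eq_norm, dist_comm]
    exact hn.le
  refine ⟨c / 2, by positivity, le_trans ?_ (add_le_add hA hB)⟩
  rw [← smul_add, div_eq_mul_one_div, map_mul, ← Algebra.smul_def]
  refine smul_le_smul_of_nonneg_left ?_ hc0.le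
  have h2 : Sₙ + (1 - S) = 1 - (S - Sₙ) := by abel
  rw [h2, le_sub_comm]
  convert hC using 1
  rw [sub_eq_iff_eq_add, ← map_add]
  norm_num

/-- The integral of a field with spectra in an interval, completed by a multiple of the defect of
the field, has its spectrum in that interval. -/
theorem spectrum_subset [OpensMeasurableSpace T] (hΨ : IsSubunitalField μ Ψ) {J : Set ℝ}
    (hJ : J.OrdConnected) {X : T → A} (hX : IsContinuousField J X)
    (hXi : Integrable (fun t => Ψ t (X t)) μ) {x₀ : ℝ} (hx₀ : x₀ ∈ J) :
    IsSelfAdjoint ((∫ t, Ψ t (X t) ∂μ) + x₀ • (1 - ∫ t, Ψ t 1 ∂μ)) ∧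
      spectrum ℝ ((∫ t, Ψ t (X t) ∂μ) + x₀ • (1 - ∫ t, Ψ t 1 ∂μ)) ⊆ J := by
  have hsa : IsSelfAdjoint ((∫ t, Ψ t (X t) ∂μ) + x₀ • (1 - ∫ t, Ψ t 1 ∂μ)) :=
    (isSelfAdjoint_integral fun t => LinearMap.isSelfAdjoint_of_nonneg (hΨ.nonneg t)
      (hX.2 t).1).add ((IsSelfAdjoint.one B |>.sub
        (isSelfAdjoint_integral fun t => .of_nonneg (hΨ.nonneg t 1 zero_le_one))).real_smul _)
  refine ⟨hsa, fun r hr => ?_⟩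
  by_contra hrJ
  -- A point `r` outside `J` lies strictly to one side of all of `J`. The integrated gap to `r` is
  -- then bounded below by a positive constant, even if `r` is an excluded endpoint.
  rcases le_total r x₀ with hle | hle
  · have hlt : ∀ x ∈ J, r < x := fun x hx => by
      by_contra! h
      exact hrJ (hJ.out hx hx₀ ⟨h, hle⟩)
    obtain ⟨c, hc, hcY⟩ := hΨ.exists_algebraMap_le (Z := fun t => X t - algebraMap ℝ A r)
      (hX.1.sub continuous_const) (fun t => by
        obtain ⟨a, ha, -, -, haX, -⟩ := exists_algebraMap_le_and_le hx₀ (hX.2 t).1 (hX.2 t).2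
        refine ⟨a - r, sub_pos.2 (hlt a ha), ?_⟩
        rw [map_sub]
        exact sub_le_sub_right haX _)
      (by
        simp only [map_sub, LinearMap.map_algebraMap_real]
        exact hXi.sub (hΨ.integrable_one.smul r)) (sub_pos.2 (hlt x₀ hx₀))
    have h1 : algebraMap ℝ B (c + r) ≤ (∫ t, Ψ t (X t) ∂μ) + x₀ • (1 - ∫ t, Ψ t 1 ∂μ) := by
      rw [map_add, ← le_sub_iff_add_le]
      refine hcY.trans_eq ?_
      simp only [map_sub, LinearMap.map_algebraMap_real]
      rw [integral_sub hXi (hΨ.integrable_one.fun_smul r), integral_smul,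
        Algebra.algebraMap_eq_smul_one]
      module
    linarith [(algebraMap_le_iff_le_spectrum hsa).1 h1 r hr]
  · have hlt : ∀ x ∈ J, x < r := fun x hx => by
      by_contra! h
      exact hrJ (hJ.out hx₀ hx ⟨hle, h⟩)
    obtain ⟨c, hc, hcY⟩ := hΨ.exists_algebraMap_le (Z := fun t => algebraMap ℝ A r - X t)
      (continuous_const.sub hX.1) (fun t => by
        obtain ⟨-, -, b, hb, -, hbX⟩ := exists_algebraMap_le_and_le hx₀ (hX.2 t).1 (hX.2 t).2
        refine ⟨r - b, sub_pos.2 (hlt b hb), ?_⟩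
        rw [map_sub]
        exact sub_le_sub_left hbX _)
      (by
        simp only [map_sub, LinearMap.map_algebraMap_real]
        exact (hΨ.integrable_one.smul r).sub hXi) (sub_pos.2 (hlt x₀ hx₀))
    have h1 : (∫ t, Ψ t (X t) ∂μ) + x₀ • (1 - ∫ t, Ψ t 1 ∂μ) ≤ algebraMap ℝ B (r - c) := by
      rw [map_sub, le_sub_comm]
      refine hcY.trans_eq ?_
      simp only [map_sub, LinearMap.map_algebraMap_real]
      rw [integral_sub (hΨ.integrable_one.fun_smul r) hXi, integral_smul,
        Algebra.algebraMap_eq_smul_one]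
      module
    linarith [(le_algebraMap_iff_spectrum_le hsa).1 h1 r hr]

end IsSubunitalField

end PositiveField

/-! ### Jensen's inequality for subunital fields -/

section AffineExtension

open unitInterval

/-- A function on the unit interval, transported affinely to `[a, b]` and extended to the line by
constants. -/
noncomputable def affineExtension (a b : ℝ) (g : C(I, ℝ)) (x : ℝ) : ℝ :=
  Set.IccExtend zero_le_one g ((x - a) / (b - a))

theorem continuous_affineExtension (a b : ℝ) (g : C(I, ℝ)) : Continuous (affineExtension a b g) :=
  g.continuous.Icc_extend'.comp (by fun_prop)

theorem abs_affineExtension_le (a b : ℝ) (g : C(I, ℝ)) (x : ℝ) : |affineExtension a b g x| ≤ ‖g‖ :=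
  g.norm_coe_le_norm _

theorem affineExtension_of_mem {a b x : ℝ} (hx : x ∈ Set.Icc a b) (g : C(I, ℝ)) {k : ℝ → ℝ}
    (hg : ∀ s : I, g s = k (a + (b - a) * s)) : affineExtension a b g x = k x := by
  have hab : 0 ≤ b - a := sub_nonneg.2 (hx.1.trans hx.2)
  have hmem : (x - a) / (b - a) ∈ Set.Icc (0 : ℝ) 1 :=
    ⟨div_nonneg (sub_nonneg.2 hx.1) hab, div_le_one_of_le₀ (by linarith [hx.2]) hab⟩
  rw [affineExtension, Set.IccExtend_of_mem _ _ hmem, hg]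
  congr 1
  -- If `a = b`, the quotient is `0` by convention and `x = a`.
  rcases hab.eq_or_lt with h | h
  · simp only [← h, zero_mul, add_zero]
    linarith [hx.1, hx.2]
  · field_simp
    ring

variable {A B : Type*} [CStarAlgebra A] [PartialOrder A] [StarOrderedRing A]
  [CStarAlgebra B] [PartialOrder B] [StarOrderedRing B]
  {T : Type*} [TopologicalSpace T] [MeasurableSpace T]

omit [PartialOrder A] [StarOrderedRing A] [MeasurableSpace T] in
theorem IsContinuousField.continuous_cfc_affineExtension {J : Set ℝ} {X : T → A}
    (hX : IsContinuousField J X) (a b : ℝ) (g : C(I, ℝ)) :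
    Continuous fun t => cfc (affineExtension a b g) (X t) :=
  IsContinuousField.continuous_cfc (J := Set.univ) ⟨hX.1, fun t => ⟨(hX.2 t).1, Set.subset_univ _⟩⟩
    Set.ordConnected_univ (continuous_affineExtension a b g).continuousOn

namespace IsSubunitalField

variable {μ : Measure T} {Ψ : T → A →ₗ[ℝ] B}

theorem integrable_cfc_affineExtension (hΨ : IsSubunitalField μ Ψ) {J : Set ℝ} {X : T → A}
    (hX : IsContinuousField J X) (a b : ℝ) (g : C(I, ℝ)) :
    Integrable (fun t => Ψ t (cfc (affineExtension a b g) (X t))) μ :=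
  hΨ.integrable_of_norm_le (hX.continuous_cfc_affineExtension a b g)
    (fun _ => cfc_predicate _ _) fun _ =>
      norm_cfc_le (norm_nonneg g) fun x _ => abs_affineExtension_le a b g x

/-- The positive linear map on `C(I, ℝ)` obtained from a field by functional calculus, the interval
being mapped to `[a, b]`. -/
noncomputable def functionalCalculusMap (hΨ : IsSubunitalField μ Ψ) {J : Set ℝ} {X : T → A}
    (hX : IsContinuousField J X) (a b x₀ : ℝ) : C(I, ℝ) →ₗ[ℝ] B where
  toFun g := (∫ t, Ψ t (cfc (affineExtension a b g) (X t)) ∂μ) +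
    affineExtension a b g x₀ • (1 - ∫ t, Ψ t 1 ∂μ)
  map_add' g₁ g₂ := by
    have h : ∀ g, ∀ t, ContinuousOn (affineExtension a b g) (spectrum ℝ (X t)) := fun g t =>
      (continuous_affineExtension a b g).continuousOn
    have h1 : ∀ t, cfc (affineExtension a b (g₁ + g₂)) (X t) =
        cfc (affineExtension a b g₁) (X t) + cfc (affineExtension a b g₂) (X t) := fun t =>
      cfc_add (X t) _ _ (h _ t) (h _ t)
    have h2 : affineExtension a b (g₁ + g₂) x₀ =
      affineExtension a b g₁ x₀ + affineExtension a b g₂ x₀ := rfl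
    simp only [h1, map_add, h2]
    rw [integral_add (hΨ.integrable_cfc_affineExtension hX a b g₁)
      (hΨ.integrable_cfc_affineExtension hX a b g₂)]
    module
  map_smul' c g := by
    have h1 : ∀ t, cfc (affineExtension a b (c • g)) (X t) =
        c • cfc (affineExtension a b g) (X t) := fun t =>
      cfc_smul c _ (X t) (continuous_affineExtension a b g).continuousOn
    have h2 : affineExtension a b (c • g) x₀ = c * affineExtension a b g x₀ := rfl
    simp only [h1, map_smul, h2, integral_smul, RingHom.id_apply]
    module

theorem functionalCalculusMap_nonneg (hΨ : IsSubunitalField μ Ψ) {J : Set ℝ} {X : T → A}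
    (hX : IsContinuousField J X) (a b x₀ : ℝ) {g : C(I, ℝ)} (hg : 0 ≤ g) :
    0 ≤ hΨ.functionalCalculusMap hX a b x₀ g :=
  add_nonneg (integral_nonneg fun t => hΨ.nonneg t _ (cfc_nonneg fun _ _ => hg _))
    (smul_nonneg (hg _) (sub_nonneg.2 hΨ.integral_one_le))

theorem functionalCalculusMap_one (hΨ : IsSubunitalField μ Ψ) {J : Set ℝ} {X : T → A}
    (hX : IsContinuousField J X) (a b x₀ : ℝ) : hΨ.functionalCalculusMap hX a b x₀ 1 = 1 := by
  have h1 : ∀ t, cfc (affineExtension a b 1) (X t) = 1 := fun t =>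
    cfc_one ℝ (X t) (hX.2 t).1
  have h2 : affineExtension a b 1 x₀ = 1 := rfl
  change (∫ t, Ψ t (cfc (affineExtension a b 1) (X t)) ∂μ) +
    affineExtension a b 1 x₀ • (1 - ∫ t, Ψ t 1 ∂μ) = 1
  simp only [h1, h2, one_smul]
  abel

theorem functionalCalculusMap_eq (hΨ : IsSubunitalField μ Ψ) {J : Set ℝ} {X : T → A}
    (hX : IsContinuousField J X) {a b x₀ : ℝ} (hx₀ : x₀ ∈ Set.Icc a b)
    (hab : ∀ᵐ t ∂μ, spectrum ℝ (X t) ⊆ Set.Icc a b) {g : C(I, ℝ)} {k : ℝ → ℝ}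
    (hg : ∀ s : I, g s = k (a + (b - a) * s)) :
    hΨ.functionalCalculusMap hX a b x₀ g =
      (∫ t, Ψ t (cfc k (X t)) ∂μ) + k x₀ • (1 - ∫ t, Ψ t 1 ∂μ) := by
  rw [← affineExtension_of_mem hx₀ g hg]
  refine congrArg (fun y : B => y + affineExtension a b g x₀ • (1 - ∫ t, Ψ t 1 ∂μ))
    (integral_congr_ae ?_)
  filter_upwards [hab] with t ht
  rw [cfc_congr fun x hx => affineExtension_of_mem (ht hx) g hg]

variable {K : Type u} [NormedAddCommGroup K] [InnerProductSpace ℂ K] [CompleteSpace K]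

/-- The Jensen inequality for a field with spectra almost everywhere in a compact interval. -/
theorem cfc_le_of_ae_subset_Icc {Ψ : T → A →ₗ[ℝ] (K →L[ℂ] K)} (hΨ : IsSubunitalField μ Ψ)
    {J : Set ℝ} {f : ℝ → ℝ} (hf : OperatorConvexOn.{u} J f) {X : T → A}
    (hX : IsContinuousField J X) {a b x₀ : ℝ} (ha : a ∈ J) (hb : b ∈ J)
    (hx₀ : x₀ ∈ Set.Icc a b) (hab : ∀ᵐ t ∂μ, spectrum ℝ (X t) ⊆ Set.Icc a b) :
    cfc f ((∫ t, Ψ t (X t) ∂μ) + x₀ • (1 - ∫ t, Ψ t 1 ∂μ)) ≤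
      (∫ t, Ψ t (cfc f (X t)) ∂μ) + f x₀ • (1 - ∫ t, Ψ t 1 ∂μ) := by
  have hle : 0 ≤ b - a := sub_nonneg.2 (hx₀.1.trans hx₀.2)
  have hmem : ∀ s : I, a + (b - a) * s ∈ J := fun s =>
    hf.1.out ha hb ⟨by nlinarith [s.2.1], by nlinarith [s.2.2]⟩
  let G : C(I, ℝ) := ⟨fun s => a + (b - a) * s, by fun_prop⟩
  let F : C(I, ℝ) := ⟨fun s => f (a + (b - a) * s),
    hf.2.1.comp_continuous (by fun_prop) hmem⟩
  have h := hf.cfc_map_le (hΨ.functionalCalculusMap hX a b x₀)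
    (fun g hg => hΨ.functionalCalculusMap_nonneg hX a b x₀ hg)
    (hΨ.functionalCalculusMap_one hX a b x₀) (G := G) (F := F) (fun s => rfl) hmem fun s => rfl
  rw [hΨ.functionalCalculusMap_eq hX hx₀ hab (k := id) (g := G) fun s => rfl,
    hΨ.functionalCalculusMap_eq hX hx₀ hab (k := f) (g := F) fun s => rfl] at h
  simpa only [cfc_id ℝ _ (hX.2 _).1, id] using h

/-- The Jensen inequality for an operator convex function and a subunital field of positive linear
maps, the defect of the field being placed at a point of the interval. -/
theorem cfc_le [OpensMeasurableSpace T] {Ψ : T → A →ₗ[ℝ] (K →L[ℂ] K)}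
    (hΨ : IsSubunitalField μ Ψ) {J : Set ℝ} {f : ℝ → ℝ} (hf : OperatorConvexOn.{u} J f) {X : T → A}
    (hX : IsContinuousField J X) (hXi : Integrable (fun t => Ψ t (X t)) μ)
    (hfXi : Integrable (fun t => Ψ t (cfc f (X t))) μ) {x₀ : ℝ} (hx₀ : x₀ ∈ J) :
    cfc f ((∫ t, Ψ t (X t) ∂μ) + x₀ • (1 - ∫ t, Ψ t 1 ∂μ)) ≤
      (∫ t, Ψ t (cfc f (X t)) ∂μ) + f x₀ • (1 - ∫ t, Ψ t 1 ∂μ) := by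
  obtain ⟨a, b, ha, hb, haJ, hbJ, hex⟩ := hf.1.exists_exhaustion hx₀
  set s : ℕ → Set T := fun n => {t | algebraMap ℝ A (a n) ≤ X t ∧ X t ≤ algebraMap ℝ A (b n)}
    with hs
  have hsm : ∀ n, MeasurableSet (s n) := fun n =>
    ((isClosed_le continuous_const hX.1).inter (isClosed_le hX.1 continuous_const)).measurableSet
  have hmono : Monotone s := fun m n hmn t ht =>
    ⟨(algebraMap_mono A (ha hmn)).trans ht.1, ht.2.trans (algebraMap_mono A (hb hmn))⟩
  have hU : ⋃ n, s n = Set.univ := Set.eq_univ_of_forall fun t => by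
    obtain ⟨c, hc, d, hd, hcX, hXd⟩ := exists_algebraMap_le_and_le hx₀ (hX.2 t).1 (hX.2 t).2
    obtain ⟨n, hcn, hdn⟩ := ((hex c hc).and (hex d hd)).exists
    exact Set.mem_iUnion.2 ⟨n, (algebraMap_mono A hcn.1).trans hcX,
      hXd.trans (algebraMap_mono A hdn.2)⟩
  have hlim : ∀ {F : T → K →L[ℂ] K}, Integrable F μ →
      Tendsto (fun n => ∫ t in s n, F t ∂μ) atTop (𝓝 (∫ t, F t ∂μ)) := fun {F} hF => by
    have := tendsto_setIntegral_of_monotone hsm hmono (hF.integrableOn (s := ⋃ n, s n))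
    rwa [hU, setIntegral_univ] at this
  -- As `s n` grows, the defect of the restricted field decreases to that of the full one, so both
  -- sides converge.
  have hY := (hlim hXi).add (((hlim hΨ.integrable_one).const_sub 1).const_smul x₀)
  have hR := (hlim hfXi).add (((hlim hΨ.integrable_one).const_sub 1).const_smul (f x₀))
  have hL : Tendsto (fun n => cfc f ((∫ t in s n, Ψ t (X t) ∂μ) +
      x₀ • (1 - ∫ t in s n, Ψ t 1 ∂μ))) atTop
      (𝓝 (cfc f ((∫ t, Ψ t (X t) ∂μ) + x₀ • (1 - ∫ t, Ψ t 1 ∂μ)))) := by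
    -- Continuity of `cfc f` applies because the limit and all approximants have spectrum in `J`.
    refine (continuousOn_cfc_of_ordConnected hf.1 hf.2.1 _
      (hΨ.spectrum_subset hf.1 hX hXi hx₀)).tendsto.comp (tendsto_nhdsWithin_iff.2 ⟨hY, ?_⟩)
    exact .of_forall fun n => (hΨ.restrict (s n)).spectrum_subset hf.1 hX hXi.restrict hx₀
  refine le_of_tendsto_of_tendsto hL hR ?_
  filter_upwards [hex x₀ hx₀] with n hn
  refine (hΨ.restrict (s n)).cfc_le_of_ae_subset_Icc hf hX (haJ n) (hbJ n) hn ?_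
  filter_upwards [ae_restrict_mem (hsm n)] with t ht
  exact spectrum_subset_Icc_of_le (hX.2 t).1 ht.1 ht.2

end IsSubunitalField

end AffineExtension

/-! ### Algebra of the generalized perspective -/

section Perspective

variable {A : Type*} [CStarAlgebra A] {J' : Set ℝ} {h : ℝ → ℝ} {R : A}

theorem continuousOn_inv_sqrt_comp (hh : ContinuousOn h J') (hpos : ∀ x ∈ J', 0 < h x) :
    ContinuousOn (fun x => (Real.sqrt (h x))⁻¹) J' :=
  hh.sqrt.inv₀ fun x hx => (Real.sqrt_pos.2 (hpos x hx)).ne'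

theorem sqrtOf_eq_cfc (hh : ContinuousOn h J') (hR : IsSelfAdjoint R) (hRJ : spectrum ℝ R ⊆ J') :
    sqrtOf h R = cfc (fun x => Real.sqrt (h x)) R :=
  (cfc_comp' Real.sqrt h R Real.continuous_sqrt.continuousOn (hh.mono hRJ) hR).symm

theorem invSqrtOf_eq_cfc (hh : ContinuousOn h J') (hpos : ∀ x ∈ J', 0 < h x)
    (hR : IsSelfAdjoint R) (hRJ : spectrum ℝ R ⊆ J') :
    invSqrtOf h R = cfc (fun x => (Real.sqrt (h x))⁻¹) R := by
  refine (cfc_comp' (fun x => (Real.sqrt x)⁻¹) h R ?_ (hh.mono hRJ) hR).symm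
  refine Real.continuous_sqrt.continuousOn.inv₀ ?_
  rintro _ ⟨x, hx, rfl⟩
  exact (Real.sqrt_pos.2 (hpos x (hRJ hx))).ne'

theorem isSelfAdjoint_sqrtOf (h : ℝ → ℝ) (R : A) : IsSelfAdjoint (sqrtOf h R) := cfc_predicate _ _

theorem isSelfAdjoint_invSqrtOf (h : ℝ → ℝ) (R : A) : IsSelfAdjoint (invSqrtOf h R) :=
  cfc_predicate _ _

theorem isSelfAdjoint_perspectiveArg (h : ℝ → ℝ) {X : A} (hX : IsSelfAdjoint X) (R : A) :
    IsSelfAdjoint (perspectiveArg h X R) :=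
  hX.conjugate_self (isSelfAdjoint_invSqrtOf h R)

theorem sqrtOf_mul_sqrtOf (hh : ContinuousOn h J') (hpos : ∀ x ∈ J', 0 < h x)
    (hR : IsSelfAdjoint R) (hRJ : spectrum ℝ R ⊆ J') : sqrtOf h R * sqrtOf h R = cfc h R := by
  have hc := hh.sqrt.mono hRJ
  rw [sqrtOf_eq_cfc hh hR hRJ, ← cfc_mul _ _ R hc hc]
  exact cfc_congr fun x hx => Real.mul_self_sqrt (hpos x (hRJ hx)).le

theorem invSqrtOf_mul_sqrtOf (hh : ContinuousOn h J') (hpos : ∀ x ∈ J', 0 < h x)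
    (hR : IsSelfAdjoint R) (hRJ : spectrum ℝ R ⊆ J') : invSqrtOf h R * sqrtOf h R = 1 := by
  rw [sqrtOf_eq_cfc hh hR hRJ, invSqrtOf_eq_cfc hh hpos hR hRJ,
    ← cfc_mul _ _ R ((continuousOn_inv_sqrt_comp hh hpos).mono hRJ) (hh.sqrt.mono hRJ),
    ← cfc_one ℝ R hR]
  exact cfc_congr fun x hx => inv_mul_cancel₀ (Real.sqrt_pos.2 (hpos x (hRJ hx))).ne'

theorem sqrtOf_mul_invSqrtOf (hh : ContinuousOn h J') (hpos : ∀ x ∈ J', 0 < h x)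
    (hR : IsSelfAdjoint R) (hRJ : spectrum ℝ R ⊆ J') : sqrtOf h R * invSqrtOf h R = 1 := by
  rw [← star_inj, star_mul, (isSelfAdjoint_sqrtOf h R).star_eq,
    (isSelfAdjoint_invSqrtOf h R).star_eq, star_one, invSqrtOf_mul_sqrtOf hh hpos hR hRJ]

theorem invSqrtOf_conj_cfc (hh : ContinuousOn h J') (hpos : ∀ x ∈ J', 0 < h x)
    (hR : IsSelfAdjoint R) (hRJ : spectrum ℝ R ⊆ J') :
    invSqrtOf h R * cfc h R * invSqrtOf h R = 1 := by
  rw [← sqrtOf_mul_sqrtOf hh hpos hR hRJ, ← mul_assoc, invSqrtOf_mul_sqrtOf hh hpos hR hRJ,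
    one_mul, sqrtOf_mul_invSqrtOf hh hpos hR hRJ]

theorem sqrtOf_conj_invSqrtOf_conj (hh : ContinuousOn h J') (hpos : ∀ x ∈ J', 0 < h x)
    (hR : IsSelfAdjoint R) (hRJ : spectrum ℝ R ⊆ J') (X : A) :
    sqrtOf h R * (invSqrtOf h R * X * invSqrtOf h R) * sqrtOf h R = X := by
  rw [mul_assoc, mul_assoc _ _ (sqrtOf h R), invSqrtOf_mul_sqrtOf hh hpos hR hRJ, mul_one,
    ← mul_assoc, sqrtOf_mul_invSqrtOf hh hpos hR hRJ, one_mul]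

/-- Lets the inequality be proved among all operators and read back in the subalgebra. -/
theorem StarSubalgebra.coe_genPerspective (S : StarSubalgebra ℂ A) [IsClosed (S : Set A)]
    (hh : ContinuousOn h J') (hpos : ∀ x ∈ J', 0 < h x) {X Y : S} (hX : IsSelfAdjoint X)
    (hY : IsSelfAdjoint Y) (hYJ : spectrum ℝ (Y : A) ⊆ J') {J : Set ℝ} {f : ℝ → ℝ}
    (hf : ContinuousOn f J) (hXJ : spectrum ℝ (perspectiveArg h (X : A) (Y : A)) ⊆ J) :
    ((genPerspective f h X Y : S) : A) = genPerspective f h (X : A) (Y : A) := by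
  have hY' : IsSelfAdjoint (Y : A) := hY.map S.subtype
  have hYJ' : spectrum ℝ Y ⊆ J' := by rwa [← S.spectrum_real_coe]
  have h1 : ((sqrtOf h Y : S) : A) = sqrtOf h (Y : A) := by
    rw [sqrtOf_eq_cfc hh hY hYJ', sqrtOf_eq_cfc hh hY' hYJ, S.coe_cfc hY (hh.sqrt.mono hYJ')]
  have h2 : ((invSqrtOf h Y : S) : A) = invSqrtOf h (Y : A) := by
    rw [invSqrtOf_eq_cfc hh hpos hY hYJ', invSqrtOf_eq_cfc hh hpos hY' hYJ,
      S.coe_cfc hY ((continuousOn_inv_sqrt_comp hh hpos).mono hYJ')]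
  have h3 : ((perspectiveArg h X Y : S) : A) = perspectiveArg h (X : A) (Y : A) := by
    simp only [perspectiveArg, MulMemClass.coe_mul, h2]
  have h4 : ((cfc f (perspectiveArg h X Y) : S) : A) =
      cfc f (perspectiveArg h (X : A) (Y : A)) := by
    rw [S.coe_cfc (isSelfAdjoint_perspectiveArg h hX Y), h3]
    rw [← S.spectrum_real_coe, h3]
    exact hf.mono hXJ
  simp only [genPerspective, MulMemClass.coe_mul, h1, h4]

theorem genPerspective_algebraMap (f h : ℝ → ℝ) {s : ℝ} (hs : 0 < h s) (x : ℝ) :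
    perspectiveArg h (algebraMap ℝ A (h s * x)) (algebraMap ℝ A s) = algebraMap ℝ A x ∧
      genPerspective f h (algebraMap ℝ A (h s * x)) (algebraMap ℝ A s) =
        algebraMap ℝ A (h s * f x) := by
  have hs' := (Real.sqrt_pos.2 hs).ne'
  have h1 : perspectiveArg h (algebraMap ℝ A (h s * x)) (algebraMap ℝ A s) = algebraMap ℝ A x := by
    simp only [perspectiveArg, invSqrtOf, cfc_algebraMap, ← map_mul]
    congr 1
    nth_rewrite 2 [← Real.mul_self_sqrt hs.le]
    field_simp
  refine ⟨h1, ?_⟩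
  rw [genPerspective, h1]
  simp only [sqrtOf, cfc_algebraMap, ← map_mul]
  congr 1
  nth_rewrite 3 [← Real.mul_self_sqrt hs.le]
  ring

end Perspective

/-! ### Scalar convexity and affine minorants -/

section Convex

theorem OperatorConvexOn.convexOn (K : Type u) [NormedAddCommGroup K] [InnerProductSpace ℂ K]
    [CompleteSpace K] [Nontrivial K] {J : Set ℝ} {f : ℝ → ℝ} (hf : OperatorConvexOn.{u} J f) :
    ConvexOn ℝ J f := by
  refine ⟨hf.1.convex, fun x hx y hy a b ha hb hab => ?_⟩
  obtain rfl : b = 1 - a := by linarith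
  have hsp : ∀ z ∈ J, spectrum ℝ (algebraMap ℝ (K →L[ℂ] K) z) ⊆ J := fun z hz => by
    rw [spectrum.scalar_eq]
    exact Set.singleton_subset_iff.2 hz
  have h := hf.2.2 K (algebraMap ℝ _ x) (algebraMap ℝ _ y) (.algebraMap _ (.all x))
    (.algebraMap _ (.all y)) (hsp x hx) (hsp y hy) a ha (by linarith)
  simp only [cfc_algebraMap, Algebra.smul_def, ← map_mul, ← map_add] at h
  exact algebraMap_le_algebraMap.1 h

/-- A continuous convex function on an interval has an affine minorant. -/
theorem ConvexOn.exists_affine_le {J : Set ℝ} {f : ℝ → ℝ} (hf : ConvexOn ℝ J f)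
    (hc : ContinuousOn f J) : ∃ α β : ℝ, ∀ x ∈ J, α + β * x ≤ f x := by
  by_cases hJ : ∃ x ∈ J, ∃ y ∈ J, x < y
  · obtain ⟨x, hx, y, hy, hxy⟩ := hJ
    -- The secant lies below `f` outside `[x, y]`; lowering it by the bound `D` handles the compact
    -- interval itself.
    set β := (f y - f x) / (y - x) with hβ
    have hsub : Set.Icc x y ⊆ J := hf.1.ordConnected.out hx hy
    have hβy : f y = f x + β * (y - x) := by
      rw [hβ, div_mul_cancel₀ _ (sub_pos.2 hxy).ne']; ring
    obtain ⟨D, hD⟩ := isCompact_Icc.exists_bound_of_continuousOn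
      (f := fun w => f x + β * (w - x) - f w) (s := Set.Icc x y)
      ((by fun_prop : Continuous fun w => f x + β * (w - x)).continuousOn.sub (hc.mono hsub))
    have hD0 : 0 ≤ D := (norm_nonneg _).trans (hD x ⟨le_rfl, hxy.le⟩)
    refine ⟨f x - β * x - D, β, fun w hw => ?_⟩
    rcases lt_or_ge w x with h1 | h1
    · have := hf.slope_mono_adjacent hw hy h1 hxy
      rw [← hβ, div_le_iff₀ (sub_pos.2 h1)] at this
      linarith
    rcases le_or_gt w y with h2 | h2
    · have := (le_abs_self _).trans (hD w ⟨h1, h2⟩)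
      linarith
    · have := hf.slope_mono_adjacent hx hw hxy h2
      rw [← hβ, le_div_iff₀ (sub_pos.2 h2)] at this
      linarith
  · push Not at hJ
    rcases J.eq_empty_or_nonempty with rfl | ⟨x, hx⟩
    · exact ⟨0, 0, fun x hx => hx.elim⟩
    · refine ⟨f x, 0, fun y hy => ?_⟩
      rw [le_antisymm (hJ x hx y hy) (hJ y hy x hx)]
      simp

end Convex

/-! ### Jensen's inequality for perspectives -/

section PerspectiveJensen

variable {A : Type*} [CStarAlgebra A] [PartialOrder A] [StarOrderedRing A]
  {K : Type u} [NormedAddCommGroup K] [InnerProductSpace ℂ K] [CompleteSpace K]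
  {T : Type*} [TopologicalSpace T] [MeasurableSpace T]

/-- Conjugating the maps of a field. -/
noncomputable def conjField {B : Type*} [CStarAlgebra B] (Ψ : T → A →ₗ[ℝ] B) (D : T → A) (C : B)
    (t : T) : A →ₗ[ℝ] B where
  toFun X := C * Ψ t (D t * X * D t) * C
  map_add' X Y := by simp only [mul_add, add_mul, map_add]
  map_smul' c X := by
    simp only [mul_smul_comm, smul_mul_assoc, map_smul, RingHom.id_apply]

omit [TopologicalSpace T] in
theorem integral_mul_mul {B : Type*} [CStarAlgebra B] {μ : Measure T} {F : T → B}
    (hF : Integrable F μ) (C : B) : ∫ t, C * F t * C ∂μ = C * (∫ t, F t ∂μ) * C := by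
  have h := ((ContinuousLinearMap.mul ℝ B).flip C ∘L
    ContinuousLinearMap.mul ℝ B C).integral_comp_comm hF
  simpa using h

omit [TopologicalSpace T] in
theorem MeasureTheory.Integrable.mul_mul {B : Type*} [CStarAlgebra B] {μ : Measure T} {F : T → B}
    (hF : Integrable F μ) (C : B) : Integrable (fun t => C * F t * C) μ := by
  have h := ((ContinuousLinearMap.mul ℝ B).flip C ∘L
    ContinuousLinearMap.mul ℝ B C).integrable_comp hF
  simpa using h

theorem IsSubunitalField.conjField {B : Type*} [CStarAlgebra B] [PartialOrder B]
    [StarOrderedRing B] {μ : Measure T} {Ψ : T → A →ₗ[ℝ] B}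
    (hΨ : IsSubunitalField μ Ψ) {D : T → A} (hD : Continuous D) (hDs : ∀ t, IsSelfAdjoint (D t))
    {C : B} (hC : IsSelfAdjoint C) (hi : Integrable (fun t => Ψ t (D t * D t)) μ)
    (hle : C * (∫ t, Ψ t (D t * D t) ∂μ) * C ≤ 1) : IsSubunitalField μ (conjField Ψ D C) where
  nonneg t a ha := hC.conjugate_nonneg (hΨ.nonneg t _ ((hDs t).conjugate_nonneg ha))
  aestronglyMeasurable Z hZ hZs :=
    ((hΨ.aestronglyMeasurable (fun t => D t * Z t * D t) ((hD.mul hZ).mul hD)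
      fun t => (hZs t).conjugate_self (hDs t)).const_mul C).mul_const C
  integrable_one := by
    simpa only [_root_.conjField, LinearMap.coe_mk, AddHom.coe_mk, mul_one] using hi.mul_mul C
  integral_one_le := by
    simpa only [_root_.conjField, LinearMap.coe_mk, AddHom.coe_mk, mul_one, integral_mul_mul hi C]
      using hle

theorem OperatorConcaveOn.continuousOn {J' : Set ℝ} {h : ℝ → ℝ}
    (hh : OperatorConcaveOn.{u} J' h) : ContinuousOn h J' :=
  hh.2.1.neg.congr fun x _ => (neg_neg (h x)).symm

variable {μ : Measure T} {Ψ : T → A →ₗ[ℝ] (K →L[ℂ] K)}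

/-- A positive concave `h` lies between `0` and an affine function, whose image under the field is
integrable; the norm is monotone on positive elements. -/
theorem IsSubunitalField.integrable_cfc_concave [Nontrivial K] (hΨ : IsSubunitalField μ Ψ)
    {J' : Set ℝ} {h : ℝ → ℝ} (hh : OperatorConcaveOn.{u} J' h) (hpos : ∀ x ∈ J', 0 < h x)
    {Y : T → A} (hY : IsContinuousField J' Y) (hYi : Integrable (fun t => Ψ t (Y t)) μ) :
    Integrable (fun t => Ψ t (cfc h (Y t))) μ := by
  have hc := hh.continuousOn
  obtain ⟨α, β, hαβ⟩ := (hh.convexOn K).exists_affine_le hh.2.1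
  have hle : ∀ t, cfc h (Y t) ≤ algebraMap ℝ A (-α) + (-β) • Y t := fun t => by
    have h1 : algebraMap ℝ A (-α) + (-β) • Y t = cfc (fun x => -α + -β * x) (Y t) := by
      rw [cfc_const_add (-α) (fun x => -β * x) (Y t) (by fun_prop) (hY.2 t).1,
        cfc_const_mul_id (-β) (Y t) (hY.2 t).1]
    rw [h1]
    exact cfc_mono (fun x hx => by linarith [hαβ x ((hY.2 t).2 hx)]) (hc.mono (hY.2 t).2)
      (by fun_prop)
  refine ((hΨ.integrable_one.smul (-α)).add (hYi.smul (-β))).norm.mono'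
    (hΨ.aestronglyMeasurable _ (hY.continuous_cfc hh.1 hc) fun t => cfc_predicate _ _)
    (.of_forall fun t => ?_)
  refine CStarAlgebra.norm_le_norm_of_nonneg_of_le (hΨ.nonneg t _ (cfc_nonneg fun x hx =>
    (hpos x ((hY.2 t).2 hx)).le)) ?_
  have := LinearMap.mono_of_nonneg (hΨ.nonneg t) (hle t)
  rwa [map_add, LinearMap.map_algebraMap_real, map_smul] at this

/-- The Jensen inequality for generalized perspectives. -/
theorem IsSubunitalField.genPerspective_le [Nontrivial K] [OpensMeasurableSpace T]
    (hΨ : IsSubunitalField μ Ψ) (hΨ1 : ∫ t, Ψ t 1 ∂μ = 1) {J J' : Set ℝ} (h0J : (0 : ℝ) ∈ J)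
    {y₀ : ℝ} (hy₀ : y₀ ∈ J') {f h : ℝ → ℝ} (hf : OperatorConvexOn.{u} J f) (hf0 : f 0 ≤ 0)
    (hh : OperatorConcaveOn.{u} J' h) (hpos : ∀ x ∈ J', 0 < h x) {X Y : T → A}
    (hX : IsContinuousField Set.univ X) (hY : IsContinuousField J' Y)
    (hXY : ∀ t, spectrum ℝ (perspectiveArg h (X t) (Y t)) ⊆ J)
    (hXi : Integrable (fun t => Ψ t (X t)) μ) (hYi : Integrable (fun t => Ψ t (Y t)) μ)
    (hfi : Integrable (fun t => Ψ t (genPerspective f h (X t) (Y t))) μ) :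
    IsSelfAdjoint (∫ t, Ψ t (X t) ∂μ) ∧
      (IsSelfAdjoint (∫ t, Ψ t (Y t) ∂μ) ∧ spectrum ℝ (∫ t, Ψ t (Y t) ∂μ) ⊆ J') ∧
      spectrum ℝ (perspectiveArg h (∫ t, Ψ t (X t) ∂μ) (∫ t, Ψ t (Y t) ∂μ)) ⊆ J ∧
      genPerspective f h (∫ t, Ψ t (X t) ∂μ) (∫ t, Ψ t (Y t) ∂μ) ≤
        ∫ t, Ψ t (genPerspective f h (X t) (Y t)) ∂μ := by
  have hc := hh.continuousOn
  have hX' : IsSelfAdjoint (∫ t, Ψ t (X t) ∂μ) := isSelfAdjoint_integral fun t =>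
    LinearMap.isSelfAdjoint_of_nonneg (hΨ.nonneg t) (hX.2 t).1
  have hsp := hΨ.spectrum_subset hh.1 hY hYi hy₀
  have hhi := hΨ.integrable_cfc_concave hh hpos hY hYi
  have hneg : ∀ Z : A, cfc (fun x => -h x) Z = -cfc h Z := fun Z => cfc_neg h Z
  -- Jensen for `-h`, which amounts to `∫ Ψ_t(h(Y_t)) ≤ h(R)`.
  have hJh := hΨ.cfc_le hh hY hYi (by simpa only [hneg, map_neg] using hhi.fun_neg) hy₀
  simp only [hΨ1, sub_self, smul_zero, add_zero, hneg, map_neg, integral_neg] at hsp hJh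
  set L := ∫ t, Ψ t (X t) ∂μ with hL
  set R := ∫ t, Ψ t (Y t) ∂μ with hR
  rw [cfc_neg, neg_le_neg_iff] at hJh
  set C := invSqrtOf h R with hC
  have hCs : IsSelfAdjoint C := isSelfAdjoint_invSqrtOf h R
  set D : T → A := fun t => sqrtOf h (Y t) with hD
  have hDD : ∀ t, D t * D t = cfc h (Y t) := fun t =>
    sqrtOf_mul_sqrtOf hc hpos (hY.2 t).1 (hY.2 t).2
  have hDc : Continuous D := by
    have : D = fun t => cfc (fun x => Real.sqrt (h x)) (Y t) :=
      funext fun t => sqrtOf_eq_cfc hc (hY.2 t).1 (hY.2 t).2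
    rw [this]
    exact hY.continuous_cfc hh.1 hc.sqrt
  have hEc : Continuous fun t => invSqrtOf h (Y t) := by
    have : (fun t => invSqrtOf h (Y t)) = fun t => cfc (fun x => (Real.sqrt (h x))⁻¹) (Y t) :=
      funext fun t => invSqrtOf_eq_cfc hc hpos (hY.2 t).1 (hY.2 t).2
    rw [this]
    exact hY.continuous_cfc hh.1 (continuousOn_inv_sqrt_comp hc hpos)
  have hΨ' : IsSubunitalField μ (_root_.conjField Ψ D C) := by
    refine hΨ.conjField hDc (fun t => isSelfAdjoint_sqrtOf h (Y t)) hCs (by simpa only [hDD]) ?_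
    simp only [hDD]
    refine (hCs.conjugate_le_conjugate hJh).trans_eq ?_
    exact invSqrtOf_conj_cfc hc hpos hsp.1 hsp.2
  have hP : IsContinuousField J fun t => perspectiveArg h (X t) (Y t) :=
    ⟨(hEc.mul hX.1).mul hEc, fun t => ⟨isSelfAdjoint_perspectiveArg h (hX.2 t).1 _, hXY t⟩⟩
  -- The inner roots cancel, so the new field integrates to `C L C`, the perspective argument of `L`
  -- and `R`.
  have h1 : ∀ t, _root_.conjField Ψ D C t (perspectiveArg h (X t) (Y t)) = C * Ψ t (X t) * C :=
    fun t => congrArg (fun Z => C * Ψ t Z * C)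
      (sqrtOf_conj_invSqrtOf_conj hc hpos (hY.2 t).1 (hY.2 t).2 (X t))
  have h2 : ∀ t, _root_.conjField Ψ D C t (cfc f (perspectiveArg h (X t) (Y t))) =
      C * Ψ t (genPerspective f h (X t) (Y t)) * C := fun t => rfl
  have hi1 : Integrable (fun t => _root_.conjField Ψ D C t (perspectiveArg h (X t) (Y t))) μ := by
    simpa only [h1] using hXi.mul_mul C
  have hi2 : Integrable (fun t => _root_.conjField Ψ D C t
      (cfc f (perspectiveArg h (X t) (Y t)))) μ := hfi.mul_mul C
  have hspP := (hΨ'.spectrum_subset hf.1 hP hi1 h0J).2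
  have hJf := hΨ'.cfc_le hf hP hi1 hi2 h0J
  simp only [h1, h2, integral_mul_mul hXi C, integral_mul_mul hfi C, zero_smul, add_zero]
    at hspP hJf
  refine ⟨hX', hsp, hspP, ?_⟩
  -- The defect contributes `f 0` times a positive operator, which is dropped because `f 0 ≤ 0`.
  have hJf' : cfc f (C * L * C) ≤ C * (∫ t, Ψ t (genPerspective f h (X t) (Y t)) ∂μ) * C :=
    hJf.trans (add_le_of_nonpos_right
      (smul_nonpos_of_nonpos_of_nonneg hf0 (sub_nonneg.2 hΨ'.integral_one_le)))
  refine ((isSelfAdjoint_sqrtOf h R).conjugate_le_conjugate hJf').trans_eq ?_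
  exact sqrtOf_conj_invSqrtOf_conj hc hpos hsp.1 hsp.2 _

end PerspectiveJensen

/-! ### Strong measurability of continuous fields -/

section Measurability

/-- Neither `T` nor `E` need be separable. Inner regularity gives countably many compact sets
covering almost all of `T`, and `F` is strongly measurable on each. -/
theorem Continuous.aestronglyMeasurable_of_regular {T E : Type*} [TopologicalSpace T] [T2Space T]
    [MeasurableSpace T] [BorelSpace T] {μ : Measure T} [IsFiniteMeasure μ] [μ.Regular]
    [TopologicalSpace E] [TopologicalSpace.PseudoMetrizableSpace E] {F : T → E}
    (hF : Continuous F) : AEStronglyMeasurable F μ := by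
  have hex : ∀ n : ℕ, ∃ k : Set T, IsCompact k ∧ μ kᶜ ≤ ENNReal.ofReal (1 / ((n : ℝ) + 1)) := by
    intro n
    have hpos : ENNReal.ofReal (1 / ((n : ℝ) + 1)) ≠ 0 := by
      simpa using (Nat.one_div_pos_of_nat (α := ℝ) (n := n))
    obtain ⟨k, -, hk, hlt⟩ := (MeasurableSet.univ (α := T)).exists_isCompact_sdiff_lt
      (measure_ne_top μ _) hpos
    exact ⟨k, hk, by rw [Set.compl_eq_univ_sdiff]; exact hlt.le⟩
  choose k hk hkμ using hex
  have hnull : μ (⋃ n, k n)ᶜ = 0 := by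
    refine le_antisymm (ge_of_tendsto' (x := atTop)
      (f := fun n : ℕ => ENNReal.ofReal (1 / ((n : ℝ) + 1))) ?_ fun n => ?_) bot_le
    · simpa using ENNReal.tendsto_ofReal tendsto_one_div_add_atTop_nhds_zero_nat
    · exact (measure_mono (Set.compl_subset_compl.2 (Set.subset_iUnion k n))).trans (hkμ n)
  rw [← Measure.restrict_eq_self_of_ae_mem (s := ⋃ n, k n) (μ := μ) (mem_ae_iff.2 hnull),
    aestronglyMeasurable_iUnion_iff]
  exact fun n => hF.continuousOn.aestronglyMeasurable_of_isCompact (hk n) (hk n).measurableSet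

end Measurability

/-! ### Unital fields between operator algebras -/

section UnitalField

variable {H K : Type*}
  [NormedAddCommGroup H] [InnerProductSpace ℂ H] [CompleteSpace H]
  [NormedAddCommGroup K] [InnerProductSpace ℂ K] [CompleteSpace K]
  {𝔄 : StarSubalgebra ℂ (H →L[ℂ] H)} [IsClosed (𝔄 : Set (H →L[ℂ] H))]
  {𝔅 : StarSubalgebra ℂ (K →L[ℂ] K)} [IsClosed (𝔅 : Set (K →L[ℂ] K))]
  {T : Type*} [TopologicalSpace T] [MeasurableSpace T]

/-- The inclusion of a closed star subalgebra as a continuous linear map. -/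
noncomputable def StarSubalgebra.inclusionCLM (S : StarSubalgebra ℂ (K →L[ℂ] K))
    [IsClosed (S : Set (K →L[ℂ] K))] : S →L[ℂ] (K →L[ℂ] K) :=
  ⟨S.subtype.toAlgHom.toLinearMap, continuous_subtype_val⟩

/-- A positive linear map between operator algebras, as a real-linear map into the operators. -/
noncomputable def PositiveLinearMap.toOperators (φ : 𝔄 →ₚ[ℂ] 𝔅) : 𝔄 →ₗ[ℝ] (K →L[ℂ] K) :=
  (𝔅.subtype.toAlgHom.toLinearMap ∘ₗ φ.toLinearMap).restrictScalars ℝ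

theorem PositiveLinearMap.toOperators_apply (φ : 𝔄 →ₚ[ℂ] 𝔅) (X : 𝔄) :
    φ.toOperators X = (φ X : K →L[ℂ] K) := rfl

omit [TopologicalSpace T] in
theorem integral_coe {μ : Measure T} {F : T → 𝔅} (hF : Integrable F μ) :
    ∫ t, (F t : K →L[ℂ] K) ∂μ = ((∫ t, F t ∂μ : 𝔅) : K →L[ℂ] K) :=
  𝔅.inclusionCLM.integral_comp_comm hF

omit [TopologicalSpace T] in
theorem integrable_coe {μ : Measure T} {F : T → 𝔅} (hF : Integrable F μ) :
    Integrable (fun t => (F t : K →L[ℂ] K)) μ :=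
  𝔅.inclusionCLM.integrable_comp hF

theorem PositiveLinearMap.toOperators_nonneg (φ : 𝔄 →ₚ[ℂ] 𝔅) (X : 𝔄) (hX : 0 ≤ X) :
    0 ≤ φ.toOperators X := by
  have h := φ.monotone' hX
  have h0 : φ 0 = 0 := map_zero φ
  change φ 0 ≤ φ X at h
  rw [h0] at h
  exact h

-- Pointwise continuity suffices because `‖Φ_t(Z_t - Z_{t₀})‖ ≤ ‖Z_t - Z_{t₀}‖ ‖Φ_t(1)‖`, and the
-- last factor is continuous in `t`.
omit [MeasurableSpace T] in
theorem continuous_toOperators {Φ : T → 𝔄 →ₚ[ℂ] 𝔅} (hΦ : ∀ a, Continuous fun t => Φ t a)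
    {Z : T → 𝔄} (hZ : Continuous Z) (hZs : ∀ t, IsSelfAdjoint (Z t)) :
    Continuous fun t => (Φ t).toOperators (Z t) := by
  have := 𝔄.starOrderedRing
  have hc : ∀ a, Continuous fun t => (Φ t).toOperators a := fun a =>
    continuous_subtype_val.comp (hΦ a)
  rw [continuous_iff_continuousAt]
  intro t₀
  have h1 : Tendsto (fun t => (Φ t).toOperators (Z t - Z t₀)) (𝓝 t₀) (𝓝 0) := by
    refine squeeze_zero_norm (fun t => LinearMap.norm_map_le_of_nonneg
      (fun a ha => (Φ t).toOperators_nonneg a ha) ((hZs t).sub (hZs t₀))) ?_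
    have : Continuous fun t => ‖Z t - Z t₀‖ * ‖(Φ t).toOperators 1‖ :=
      (hZ.sub continuous_const).norm.mul (hc 1).norm
    simpa using this.tendsto t₀
  have h2 := h1.add ((hc (Z t₀)).tendsto t₀)
  simpa only [ContinuousAt, map_sub, sub_add_cancel, zero_add] using h2

theorem IsUnitalField.isSubunitalField [T2Space T] [BorelSpace T] {μ : Measure T}
    [IsFiniteMeasure μ] [μ.Regular] {Φ : T → 𝔄 →ₚ[ℂ] 𝔅} (hΦ : IsUnitalField μ Φ) :
    IsSubunitalField μ (fun t => (Φ t).toOperators) ∧ ∫ t, (Φ t).toOperators 1 ∂μ = 1 := by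
  have h1 : ∫ t, (Φ t).toOperators 1 ∂μ = 1 := by
    have := integral_coe hΦ.2.1
    rw [hΦ.2.2] at this
    exact this
  exact ⟨⟨fun t => (Φ t).toOperators_nonneg, fun Z hZ hZs =>
    (continuous_toOperators hΦ.1 hZ hZs).aestronglyMeasurable_of_regular,
    integrable_coe hΦ.2.1, h1.le⟩, h1⟩

open ComplexOrder in
/-- The positive linear map `X ↦ r ⟪ξ, X ξ⟫`. -/
noncomputable def vectorFunctional (𝔄 : StarSubalgebra ℂ (H →L[ℂ] H))
    [IsClosed (𝔄 : Set (H →L[ℂ] H))] (𝔅 : StarSubalgebra ℂ (K →L[ℂ] K))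
    [IsClosed (𝔅 : Set (K →L[ℂ] K))] (ξ : H) {r : ℝ} (hr : 0 ≤ r) : 𝔄 →ₚ[ℂ] 𝔅 where
  toFun X := ((r : ℂ) * inner ℂ ξ ((X : H →L[ℂ] H) ξ)) • 1
  map_add' X Y := by simp [mul_add, add_smul]
  map_smul' c X := by simp [smul_smul]; ring_nf
  monotone' X Y hXY := by
    have h := ((nonneg_iff_isPositive _).1
      (sub_nonneg.2 (show (X : H →L[ℂ] H) ≤ Y from hXY))).inner_nonneg_right ξ
    rw [sub_apply, inner_sub_right, sub_nonneg] at h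
    change (((r : ℂ) * inner ℂ ξ ((X : H →L[ℂ] H) ξ)) • (1 : K →L[ℂ] K)) ≤
      ((r : ℂ) * inner ℂ ξ ((Y : H →L[ℂ] H) ξ)) • (1 : K →L[ℂ] K)
    exact smul_le_smul_of_nonneg_right
      (mul_le_mul_of_nonneg_left h (Complex.zero_le_real.2 hr)) zero_le_one

/-- A vector state divided by the total mass, times the identity, gives a constant unital field
whatever the two algebras are. -/
theorem exists_isUnitalField [Nontrivial H] (𝔄 : StarSubalgebra ℂ (H →L[ℂ] H))
    [IsClosed (𝔄 : Set (H →L[ℂ] H))] (𝔅 : StarSubalgebra ℂ (K →L[ℂ] K))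
    [IsClosed (𝔅 : Set (K →L[ℂ] K))] (μ : Measure T) [IsFiniteMeasure μ] [NeZero μ] :
    ∃ φ : 𝔄 →ₚ[ℂ] 𝔅, IsUnitalField μ (fun _ => φ) ∧
      ∀ c : ℝ, ∫ _, φ (algebraMap ℝ 𝔄 c) ∂μ = algebraMap ℝ 𝔅 c := by
  obtain ⟨ξ, hξ⟩ := exists_norm_eq H (zero_le_one (α := ℝ))
  have hm : μ.real Set.univ ≠ 0 := by
    simp [measureReal_def, ENNReal.toReal_eq_zero_iff, NeZero.ne μ]
  set φ := vectorFunctional 𝔄 𝔅 ξ (r := (μ.real Set.univ)⁻¹) (by positivity)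
  have hφ : ∀ c : ℝ, φ (algebraMap ℝ 𝔄 c) = ((μ.real Set.univ)⁻¹ * c) • 1 := fun c => by
    have h1 : (((algebraMap ℝ 𝔄 c : 𝔄) : H →L[ℂ] H)) ξ = (c : ℂ) • ξ := by
      change (algebraMap ℝ (H →L[ℂ] H) c) ξ = _
      simp [Algebra.algebraMap_eq_smul_one]
    change (_ * inner ℂ ξ (((algebraMap ℝ 𝔄 c : 𝔄) : H →L[ℂ] H) ξ)) • (1 : 𝔅) = _
    rw [h1, inner_smul_right, inner_self_eq_norm_sq_to_K, hξ]
    simp [← Complex.coe_smul]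
  have hint : ∀ c : ℝ, ∫ _, φ (algebraMap ℝ 𝔄 c) ∂μ = algebraMap ℝ 𝔅 c := fun c => by
    rw [integral_const, hφ, smul_smul, mul_inv_cancel_left₀ hm, Algebra.algebraMap_eq_smul_one]
  refine ⟨φ, ⟨fun a => continuous_const, integrable_const _, ?_⟩, hint⟩
  simpa using hint 1

theorem algebraMap_le_algebraMap_starSubalgebra [Nontrivial K] {a b : ℝ}
    (h : algebraMap ℝ 𝔅 a ≤ algebraMap ℝ 𝔅 b) : a ≤ b :=
  (algebraMap_le_algebraMap (α := ℝ) (β := K →L[ℂ] K)).1 h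

end UnitalField

/-! ### The equivalence -/

theorem theorem2p7
    {T : Type*} [TopologicalSpace T] [T2Space T] [LocallyCompactSpace T]
    [MeasurableSpace T] [BorelSpace T]
    (μ : Measure T) [IsFiniteMeasure μ] [μ.Regular] [NeZero μ]
    {H K : Type u}
    [NormedAddCommGroup H] [InnerProductSpace ℂ H] [CompleteSpace H] [Nontrivial H]
    [NormedAddCommGroup K] [InnerProductSpace ℂ K] [CompleteSpace K] [Nontrivial K]
    (𝔄 : StarSubalgebra ℂ (H →L[ℂ] H)) [IsClosed (𝔄 : Set (H →L[ℂ] H))]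
    (𝔅 : StarSubalgebra ℂ (K →L[ℂ] K)) [IsClosed (𝔅 : Set (K →L[ℂ] K))]
    (J J' : Set ℝ) (h0J : (0 : ℝ) ∈ J) (hJ' : J'.Nonempty)
    (f₁ f₂ h : ℝ → ℝ)
    (hf₁ : OperatorConvexOn.{u} J f₁) (hf₂ : OperatorConvexOn.{u} J f₂)
    (hf₁0 : f₁ 0 ≤ 0) (hf₂0 : f₂ 0 ≤ 0)
    (hh : OperatorConcaveOn.{u} J' h) (hpos : ∀ x ∈ J', 0 < h x) :
    List.TFAE
      [ ∀ x ∈ J, f₁ x ≤ f₂ x,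
        ∀ (Φ : T → 𝔄 →ₚ[ℂ] 𝔅) (A B : T → 𝔄), IsUnitalField μ Φ →
          IsContinuousField Set.univ A → IsContinuousField J' B →
          (∀ t, spectrum ℝ (perspectiveArg h (A t) (B t)) ⊆ J) →
          Integrable (fun t => Φ t (A t)) μ → Integrable (fun t => Φ t (B t)) μ →
          Integrable (fun t => Φ t (genPerspective f₂ h (A t) (B t))) μ →
          genPerspective f₁ h (∫ t, Φ t (A t) ∂μ) (∫ t, Φ t (B t) ∂μ) ≤
            ∫ t, Φ t (genPerspective f₂ h (A t) (B t)) ∂μ,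
        ∀ (Φ : T → 𝔄 →ₚ[ℂ] 𝔅) (A : T → 𝔄), IsUnitalField μ Φ →
          IsContinuousField J A →
          Integrable (fun t => Φ t (A t)) μ → Integrable (fun t => Φ t (cfc f₂ (A t))) μ →
          cfc f₁ (∫ t, Φ t (A t) ∂μ) ≤ ∫ t, Φ t (cfc f₂ (A t)) ∂μ ] := by
  have := 𝔄.starOrderedRing
  have hc := hh.continuousOn
  have hscal : ∀ {I : Set ℝ} {x : ℝ}, x ∈ I →
      IsContinuousField I (fun _ : T => algebraMap ℝ 𝔄 x) := fun {I x} hx =>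
    ⟨continuous_const, fun _ => ⟨.algebraMap _ (.all x), by
        rw [← 𝔄.spectrum_real_coe]
        change spectrum ℝ (algebraMap ℝ (H →L[ℂ] H) x) ⊆ I
        rw [spectrum.scalar_eq]
        exact Set.singleton_subset_iff.2 hx⟩⟩
  tfae_have 1 → 2 := by
    intro hle Φ A B hΦ hA hB hAB hAi hBi hfi
    obtain ⟨hΨ, hΨ1⟩ := hΦ.isSubunitalField
    obtain ⟨y₀, hy₀⟩ := hJ'
    -- Jensen is applied to `f₂`, the function whose perspective is assumed integrable; `f₁ ≤ f₂`
    -- enters only afterwards.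
    obtain ⟨hX, hY, hsp, hJ⟩ := hΨ.genPerspective_le hΨ1 h0J hy₀ hf₂ hf₂0 hh hpos hA hB hAB
      (integrable_coe hAi) (integrable_coe hBi) (integrable_coe hfi)
    simp only [PositiveLinearMap.toOperators_apply] at hX hY hsp hJ
    rw [integral_coe hAi] at hX hsp hJ
    rw [integral_coe hBi] at hY hsp hJ
    rw [integral_coe hfi] at hJ
    change ((genPerspective f₁ h (∫ t, Φ t (A t) ∂μ) (∫ t, Φ t (B t) ∂μ) : 𝔅) : K →L[ℂ] K) ≤ _
    rw [𝔅.coe_genPerspective hc hpos (Subtype.ext hX) (Subtype.ext hY.1) hY.2 hf₁.2.1 hsp]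
    refine le_trans ?_ hJ
    exact (isSelfAdjoint_sqrtOf h _).conjugate_le_conjugate (cfc_mono (fun x hx => hle x (hsp hx))
      (hf₁.2.1.mono hsp) (hf₂.2.1.mono hsp))
  tfae_have 1 → 3 := by
    intro hle Φ A hΦ hA hAi hfi
    obtain ⟨hΨ, hΨ1⟩ := hΦ.isSubunitalField
    have hsp := hΨ.spectrum_subset hf₂.1 hA (integrable_coe hAi) h0J
    -- The defect vanishes here, so the base point `0` plays no role.
    have hJ := hΨ.cfc_le hf₂ hA (integrable_coe hAi) (integrable_coe hfi) h0J
    simp only [hΨ1, sub_self, smul_zero, add_zero] at hsp hJ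
    simp only [PositiveLinearMap.toOperators_apply] at hsp hJ
    rw [integral_coe hAi] at hsp hJ
    rw [integral_coe hfi] at hJ
    change ((cfc f₁ (∫ t, Φ t (A t) ∂μ) : 𝔅) : K →L[ℂ] K) ≤ _
    rw [𝔅.coe_cfc (Subtype.ext hsp.1) (hf₁.2.1.mono (by
      rw [← 𝔅.spectrum_real_coe]; exact hsp.2))]
    exact (cfc_mono (fun x hx => hle x (hsp.2 hx)) (hf₁.2.1.mono hsp.2)
      (hf₂.2.1.mono hsp.2)).trans hJ
  tfae_have 2 → 1 := by
    intro h2 x hx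
    obtain ⟨φ, hφ, hφc⟩ := exists_isUnitalField 𝔄 𝔅 μ
    obtain ⟨s, hs⟩ := hJ'
    have hg := genPerspective_algebraMap (A := 𝔄) f₂ h (hpos s hs) x
    -- The scalars `h s * x` and `s` have perspective argument `x`, so the inequality reads `h s *
    -- f₁ x ≤ h s * f₂ x`.
    have key := h2 (fun _ => φ) (fun _ => algebraMap ℝ 𝔄 (h s * x)) (fun _ => algebraMap ℝ 𝔄 s) hφ
      (hscal (Set.mem_univ _)) (hscal hs) (fun t => by rw [hg.1]; exact ((hscal hx).2 t).2)
      (integrable_const _) (integrable_const _) (integrable_const _)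
    rw [hg.2, hφc, hφc, hφc, (genPerspective_algebraMap f₁ h (hpos s hs) x).2] at key
    exact le_of_mul_le_mul_left (algebraMap_le_algebraMap_starSubalgebra key) (hpos s hs)
  tfae_have 3 → 1 := by
    intro h3 x hx
    obtain ⟨φ, hφ, hφc⟩ := exists_isUnitalField 𝔄 𝔅 μ
    have key := h3 (fun _ => φ) (fun _ => algebraMap ℝ 𝔄 x) hφ (hscal hx) (integrable_const _)
      (integrable_const _)
    rw [cfc_algebraMap, hφc, hφc, cfc_algebraMap] at key
    exact algebraMap_le_algebraMap_starSubalgebra key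
  tfae_finish
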